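/- Let $\Omega\subset\mathbb R^2$ be convex and compact, let $X:=\Omega\cap\mathbb Z^2$, and assume that the convex hull $\mathrm{Hull}(X)$ has non-empty interior. A vector $e=(\alpha,\beta)\in\mathbb Z^2$ is irreducible if $\gcd(\alpha,\beta)=1$. Every irreducible $e$ with Euclidean norm $\|e\|>1$ can be written in a unique way as $e=f+g$ with $f,g\in\mathbb Z^2$, $\det(f,g)=1$ and $\langle f,g\rangle\ge 0$; then $f,g$ are called the parents of $e$ (unit vectors have no parents). For $x\in X$ let $\mathcal V_{\max}(x)$ be the set of the irreducible $e\in\mathbb Z^2$ with $x+e\in X$. A family of stencils on $X$ is a collection $\mathcal V=(\mathcal V(x))_{x\in X}$ of sets $\mathcal V(x)\subset\mathcal V_{\max}(x)$ such that for every $x\in X$: (Stability) any parent $f\in\mathcal V_{\max}(x)$ of any $e\in\mathcal V(x)$ belongs to $\mathcal V(x)$; (Visibility) $\mathcal V(x)$ and $\mathcal V_{\max}(x)$ generate the same convex cone (the cone generated by $\emptyset$ being $\{0\}$). Let $\hat{\mathcal V}(x)$ be the set of those $e\in\mathcal V_{\max}(x)\setminus\mathcal V(x)$ which have parents, both belonging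 to $\mathcal V(x)$. Let $\mathrm{Conv}(\mathcal V)$ be the set of the functions $u:X\to\mathbb R$ such that for every $x\in X$: * $u(x+e)-2u(x)+u(x-e)\ge 0$ for all $e\in\mathcal V(x)$ with $x+e,\,x-e\in X$; * $u(x+e)+u(x-f)+u(x-g)-3u(x)\ge 0$ for all $e\in\mathcal V(x)$ with $\|e\|>1$, of parents $f,g$, such that $x+e,\,x-f,\,x-g\in X$; * $u(x+e)-u(x+f)-u(x+g)+u(x)\ge 0$ for all $e\in\hat{\mathcal V}(x)$, of parents $f,g$. A triangulation of $X$ is a triangulation $\mathcal T$ which covers $\mathrm{Hull}(X)$ and whose set of vertices is $X$. Write $\mathcal T\prec\mathcal V$ if $e\in\mathcal V(x)$ whenever $[x,x+e]$ is an edge of $\mathcal T$ (each edge being taken in both directions). Let $\mathrm{Conv}(\mathcal T)$ be the set of the functions $u:X\to\mathbb R$ whose piecewise linear interpolant on $\mathcal T$ is convex on $\mathrm{Hull}(X)$. **Theorem.** Let $\mathcal V$ be a family of stencils on $X$. If $\mathrm{Conv}(\mathcal V)$ has non-empty interior in the space of functions $X\to\mathbb R$, then $$\mathrm{Conv}(\mathcal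 V)=\bigcup_{\mathcal T\prec\mathcal V}\mathrm{Conv}(\mathcal T),$$ where the union is over all triangulations $\mathcal T$ of $X$ with $\mathcal T\prec\mathcal V$. -/

import Mathlib

/-! Integer points of a plane domain `Ω`, stencils on them, triangulations of them, and the
associated cones of functions. The plane is `ℝ × ℝ`; only its affine and topological structure
matters below, so the choice of a norm is irrelevant. -/

noncomputable section

namespace GridConv

/-- The inclusion of `ℤ²` in the plane. -/
def toPlane (z : ℤ × ℤ) : ℝ × ℝ := ((z.1 : ℝ), (z.2 : ℝ))

/-- The discrete domain `X = Ω ∩ ℤ²`. -/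
def gridPoints (Ω : Set (ℝ × ℝ)) : Set (ℤ × ℤ) := {z | toPlane z ∈ Ω}

/-- The convex hull `Hull(X)` of a set of integer points. -/
def hull (X : Set (ℤ × ℤ)) : Set (ℝ × ℝ) := convexHull ℝ (toPlane '' X)

/-- The convex cone generated by a set of integer vectors; `{0}` for the empty set. -/
def cone (A : Set (ℤ × ℤ)) : Set (ℝ × ℝ) :=
  (PointedCone.hull ℝ (toPlane '' A) : Set (ℝ × ℝ))

/-- Integer vectors with coprime coordinates. -/
def IsIrred (e : ℤ × ℤ) : Prop := Int.gcd e.1 e.2 = 1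

/-- `f, g` are the parents of `e`: `(f, g)` is a direct acute basis of `ℤ²` with `e = f + g`.
Such an `e` is irreducible of Euclidean norm `> 1`. Unit vectors have no parents. -/
def IsParents (f g e : ℤ × ℤ) : Prop :=
  f.1 * g.2 - f.2 * g.1 = 1 ∧ 0 ≤ f.1 * g.1 + f.2 * g.2 ∧ e = f + g

/-- The maximal stencil at `x`: the irreducible offsets from `x` to the points of `X`. -/
def maxStencil (X : Set (ℤ × ℤ)) (x : ℤ × ℤ) : Set (ℤ × ℤ) := {e | IsIrred e ∧ x + e ∈ X}

/-- A family of stencils on `X`. -/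
structure Stencils (X : Set (ℤ × ℤ)) where
  /-- the stencil at each point of `X` -/
  at' : X → Set (ℤ × ℤ)
  subset_max : ∀ x : X, at' x ⊆ maxStencil X x
  stability : ∀ (x : X) (e f g : ℤ × ℤ), e ∈ at' x → IsParents f g e →
    (f ∈ maxStencil X x → f ∈ at' x) ∧ (g ∈ maxStencil X x → g ∈ at' x)
  visibility : ∀ x : X, cone (at' x) = cone (maxStencil X x)

/-- Extension by zero to `ℤ²` of a function on `X`; the linear forms below are only applied to it
where they are supported in `X`. -/
def extend {X : Set (ℤ × ℤ)} (u : X → ℝ) : ℤ × ℤ → ℝ := Function.extend Subtype.val u 0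

/-- The segment form `S_x^e`. -/
def formS (x e : ℤ × ℤ) (u : ℤ × ℤ → ℝ) : ℝ := u (x + e) - 2 * u x + u (x - e)

/-- The triangle form `T_x^e`, where `f, g` are the parents of `e`. -/
def formT (x e f g : ℤ × ℤ) (u : ℤ × ℤ → ℝ) : ℝ := u (x + e) + u (x - f) + u (x - g) - 3 * u x

/-- The parallelogram form `P_x^e`, where `f, g` are the parents of `e`. -/
def formP (x e f g : ℤ × ℤ) (u : ℤ × ℤ → ℝ) : ℝ := u (x + e) - u (x + f) - u (x + g) + u x

/-- The cone `Conv(V)`. In the last condition `e` is a candidate for refinement at `x`: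
an element of the maximal stencil outside of `V(x)` both parents of which belong to `V(x)`. -/
def convStencils {X : Set (ℤ × ℤ)} (V : Stencils X) : Set (X → ℝ) :=
  {u | ∀ x : X,
    (∀ e ∈ V.at' x, (x : ℤ × ℤ) + e ∈ X → (x : ℤ × ℤ) - e ∈ X → 0 ≤ formS x e (extend u)) ∧
    (∀ e ∈ V.at' x, ∀ f g, IsParents f g e →
      (x : ℤ × ℤ) + e ∈ X → (x : ℤ × ℤ) - f ∈ X → (x : ℤ × ℤ) - g ∈ X →
        0 ≤ formT x e f g (extend u)) ∧
    (∀ e ∈ maxStencil X x, e ∉ V.at' x → ∀ f g, IsParents f g e →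
      f ∈ V.at' x → g ∈ V.at' x → 0 ≤ formP x e f g (extend u))}

/-- A triangulation of `X`: a simplicial complex whose set of vertices is `X` and which covers
`Hull(X)`. -/
structure Triangulation (X : Set (ℤ × ℤ)) where
  /-- the underlying simplicial complex -/
  complex : Geometry.SimplicialComplex ℝ (ℝ × ℝ)
  vertices_eq : complex.vertices = toPlane '' X
  space_eq : complex.space = hull X

/-- `T ≺ V`: for every edge `[x, x + e]` of `T` one has `e ∈ V(x)`. -/
def Triangulation.Prec {X : Set (ℤ × ℤ)} (T : Triangulation X) (V : Stencils X) : Prop :=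
  ∀ (x : X) (e : ℤ × ℤ), e ≠ 0 →
    ({toPlane x, toPlane (x + e)} : Finset (ℝ × ℝ)) ∈ T.complex.faces → e ∈ V.at' x

/-- `U` is the piecewise linear interpolant on `T` of `u`: on each simplex of `T` it is the affine
function with the values of `u` at the vertices. -/
def IsInterpolant {X : Set (ℤ × ℤ)} (T : Triangulation X) (u : X → ℝ) (U : ℝ × ℝ → ℝ) : Prop :=
  ∀ s ∈ T.complex.faces, ∃ A : (ℝ × ℝ) →ᵃ[ℝ] ℝ,
    (∀ x : X, toPlane x ∈ s → A (toPlane x) = u x) ∧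
    ∀ p ∈ convexHull ℝ (s : Set (ℝ × ℝ)), U p = A p

theorem toPlane_injective : Function.Injective toPlane := by
  intro a b h
  simp only [toPlane, Prod.mk.injEq, Int.cast_inj] at h
  exact Prod.ext h.1 h.2

theorem mem_image_of_mem_face {X : Set (ℤ × ℤ)} (T : Triangulation X) {s : Finset (ℝ × ℝ)}
    (hs : s ∈ T.complex.faces) {p : ℝ × ℝ} (hp : p ∈ s) : ∃ x : X, toPlane x = p := by
  have h : p ∈ T.complex.vertices :=
    T.complex.down_closed hs (Finset.singleton_subset_iff.2 hp) (Finset.singleton_nonempty p)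
  rw [T.vertices_eq] at h
  obtain ⟨x, hx, rfl⟩ := h
  exact ⟨⟨x, hx⟩, rfl⟩

/-- The interpolant exists. -/
theorem exists_interpolant {X : Set (ℤ × ℤ)} (T : Triangulation X) (u : X → ℝ) :
    ∃ U, IsInterpolant T u U := by
  classical
  have hA : ∀ s : Finset (ℝ × ℝ), ∃ A : (ℝ × ℝ) →ᵃ[ℝ] ℝ, s ∈ T.complex.faces →
      ∀ x : X, toPlane x ∈ s → A (toPlane x) = u x := by
    intro s
    by_cases hs : s ∈ T.complex.faces
    · have hi := T.complex.indep hs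
      obtain ⟨t, hst, ht, htop⟩ := exists_subset_affineIndependent_affineSpan_eq_top
        (k := ℝ) (s := (s : Set (ℝ × ℝ))) hi
      let b : AffineBasis t ℝ (ℝ × ℝ) := ⟨(↑), ht, by simpa using htop⟩
      have hfin : Finite t := finite_of_fin_dim_affineIndependent ℝ ht
      let hft : Fintype t := Fintype.ofFinite t
      let c : (ℝ × ℝ) → ℝ := Function.extend (fun x : X => toPlane x) u 0
      refine ⟨∑ i : t, c i • b.coord i, fun _ x hx => ?_⟩
      have hinj : Function.Injective (fun x : X => toPlane x) :=
        toPlane_injective.comp Subtype.val_injective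
      have hc : c (toPlane x) = u x := hinj.extend_apply u 0 x
      let j : t := ⟨toPlane x, hst hx⟩
      have hj : toPlane x = b j := rfl
      have key : ∀ (F : Finset t), (∑ i ∈ F, c i • b.coord i) (b j)
          = ∑ i ∈ F, c i * b.coord i (b j) := by
        intro F
        induction F using Finset.induction_on with
        | empty => simp
        | insert a F ha ih => simp [Finset.sum_insert ha, ih]
      rw [hj, key]
      simp only [AffineBasis.coord_apply, mul_ite, mul_one, mul_zero]
      rw [Finset.sum_ite_eq' Finset.univ j (fun i : t => c i)]
      simpa [j] using hc
    · exact ⟨0, fun h => absurd h hs⟩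
  choose A hA using hA
  have hcons : ∀ s ∈ T.complex.faces, ∀ t ∈ T.complex.faces, ∀ p,
      p ∈ convexHull ℝ (s : Set (ℝ × ℝ)) → p ∈ convexHull ℝ (t : Set (ℝ × ℝ)) →
        A s p = A t p := by
    intro s hs t ht p hps hpt
    have hp := T.complex.inter_subset_convexHull hs ht ⟨hps, hpt⟩
    have heq : Set.EqOn (A s) (A t) (s ∩ t : Set (ℝ × ℝ)) := by
      rintro q ⟨hqs, hqt⟩
      obtain ⟨x, rfl⟩ := mem_image_of_mem_face T hs hqs
      rw [hA s hs x hqs, hA t ht x hqt]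
    exact AffineMap.eqOn_affineSpan heq (convexHull_subset_affineSpan _ hp)
  refine ⟨fun p => if h : ∃ s ∈ T.complex.faces, p ∈ convexHull ℝ (s : Set (ℝ × ℝ)) then
    A h.choose p else 0, fun s hs => ⟨A s, hA s hs, fun p hp => ?_⟩⟩
  have h : ∃ s ∈ T.complex.faces, p ∈ convexHull ℝ (s : Set (ℝ × ℝ)) := ⟨s, hs, hp⟩
  simp only [dif_pos h]
  exact hcons _ h.choose_spec.1 s hs p h.choose_spec.2 hp

/-- The interpolant is unique on `Hull(X)`. -/
theorem IsInterpolant.eqOn {X : Set (ℤ × ℤ)} {T : Triangulation X} {u : X → ℝ}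
    {U U' : ℝ × ℝ → ℝ} (h : IsInterpolant T u U) (h' : IsInterpolant T u U') :
    Set.EqOn U U' (hull X) := by
  intro p hp
  rw [← T.space_eq, Geometry.SimplicialComplex.mem_space_iff] at hp
  obtain ⟨s, hs, hps⟩ := hp
  obtain ⟨A, hA, hU⟩ := h s hs
  obtain ⟨A', hA', hU'⟩ := h' s hs
  rw [hU p hps, hU' p hps]
  have heq : Set.EqOn A A' (s : Set (ℝ × ℝ)) := by
    intro q hq
    obtain ⟨x, rfl⟩ := mem_image_of_mem_face T hs hq
    rw [hA x hq, hA' x hq]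
  exact AffineMap.eqOn_affineSpan heq (convexHull_subset_affineSpan _ hps)

/-- The piecewise linear interpolant of `u` on `T`; its values outside of `Hull(X)` are
meaningless. -/
def interp {X : Set (ℤ × ℤ)} (T : Triangulation X) (u : X → ℝ) : ℝ × ℝ → ℝ :=
  (exists_interpolant T u).choose

theorem interp_spec {X : Set (ℤ × ℤ)} (T : Triangulation X) (u : X → ℝ) :
    IsInterpolant T u (interp T u) := (exists_interpolant T u).choose_spec

/-- The cone `Conv(T)` of the functions whose interpolant on `T` is convex on `Hull(X)`. -/
def convTriangulation {X : Set (ℤ × ℤ)} (T : Triangulation X) : Set (X → ℝ) :=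
  {u | ConvexOn ℝ (hull X) (interp T u)}

end GridConv

end

/-! Write `S`, `T`, `P` for the segment, triangle and parallelogram forms.

From stencils to triangulations: `convStencils V` is closed and convex with interior points, so it
is the closure of its interior, while the right-hand side is a finite union of closed sets. A dense
set of interior `u` is therefore enough. Induction on `‖e‖²` shows that `S` and `T` are nonnegative
in all directions, and `P` at every `e` outside the stencil, not only where the definition asks for
it (`formS_nonneg_and_formP_nonneg`, `formT_nonneg`); in the interior they are positive. For generic
`u` the contact sets of affine minorants are affinely independent, so the lower faces of the graph
are simplices. A maximum principle (`mem_contact_of_mem_convexHull`) makes every point of `X` a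
vertex: an integer point of the hull of a contact set, but outside that set, is the centre of a
primitive segment or of a triangle of area `3/2` in this hull, so the excess of `u` over the
minorant has no positive maximum. Finally an edge `[x, x + e]` with `e` outside the stencil would
contradict `P > 0`, since the minorant touches `u` at both ends and stays below it at `x + f` and `x
+ g`.

From triangulations to stencils: `S` and `T` are Jensen inequalities. For `P`, the triangle of the
triangulation at `x` in the direction `e` is unimodular, with edges `a, b` in the stencil. Stability
keeps `a, b` out of the open cone of the parents of `e`, so the parents lie in the cone of `a, b`,
and convexity gives the inequality (`formP_nonneg_of_cone`).

Both directions rest on a Stern-Brocot descent (`Stencils.mem_of_descendant`): stability propagates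
membership down the tree, and visibility prevents the parents of a missing vector from leaving `X`
(`Stencils.parents_mem`). -/

noncomputable section

namespace GridConv

/-! ### Integer vectors -/

/-- The determinant of two integer vectors. -/
def cross (a b : ℤ × ℤ) : ℤ := a.1 * b.2 - a.2 * b.1

/-- The scalar product of two integer vectors. -/
def dot (a b : ℤ × ℤ) : ℤ := a.1 * b.1 + a.2 * b.2

/-- Coprime positive integers split as in the Stern-Brocot tree. -/
theorem exists_split_of_isCoprime {p q : ℤ} (hp : 1 ≤ p) (hq : 1 ≤ q) (h : IsCoprime p q) :
    ∃ p₁ q₁ p₂ q₂ : ℤ, 1 ≤ p₁ ∧ 0 ≤ q₁ ∧ 0 ≤ p₂ ∧ 1 ≤ q₂ ∧ p = p₁ + p₂ ∧ q = q₁ + q₂ ∧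
      p₁ * q₂ - p₂ * q₁ = 1 := by
  obtain ⟨a, b, hab⟩ := h
  have hp0 : p ≠ 0 := by omega
  -- This is the future `p₂`: as `b` inverts `q` modulo `p`, it is the residue for which `p` divides
  -- `1 + q * r`, and the quotient is `q₂`.
  set r := (-b) % p with hr
  set k := (-b) / p with hk
  have hdiv : p * k + r = -b := Int.mul_ediv_add_emod (-b) p
  have hr0 : 0 ≤ r := Int.emod_nonneg _ hp0
  have hrp : r < p := Int.emod_lt_of_pos _ (by omega)
  have hs : p * (a - q * k) = 1 + q * r := by
    linear_combination hab - q * hdiv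
  have hs1 : 1 ≤ a - q * k := by
    by_contra hlt
    have : p * (a - q * k) ≤ 0 := mul_nonpos_of_nonneg_of_nonpos (by omega) (by omega)
    have : 0 ≤ q * r := mul_nonneg (by omega) hr0
    omega
  have hs2 : a - q * k ≤ q := by
    by_contra hlt
    have h1 : p * (q + 1) ≤ p * (a - q * k) := mul_le_mul_of_nonneg_left (by omega) (by omega)
    have h2 : q * r ≤ q * (p - 1) := mul_le_mul_of_nonneg_left (by omega) (by omega)
    nlinarith
  refine ⟨p - r, q - (a - q * k), r, a - q * k, by omega, by omega, hr0, hs1, by ring, by ring, ?_⟩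
  linear_combination hs

theorem isIrred_iff {e : ℤ × ℤ} : IsIrred e ↔ IsCoprime e.1 e.2 := Int.isCoprime_iff_gcd_eq_one.symm

theorem isIrred_neg {e : ℤ × ℤ} (h : IsIrred e) : IsIrred (-e) := by
  rw [isIrred_iff] at *
  exact h.neg_neg

theorem isIrred_left_of_cross {a b : ℤ × ℤ} (h : cross a b = 1) : IsIrred a :=
  isIrred_iff.2 ⟨b.2, -b.1, by rw [← h, cross]; ring⟩

theorem isIrred_right_of_cross {a b : ℤ × ℤ} (h : cross a b = 1) : IsIrred b :=
  isIrred_iff.2 ⟨-a.2, a.1, by rw [← h, cross]; ring⟩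

theorem IsIrred.ne_zero {e : ℤ × ℤ} (h : IsIrred e) : e ≠ 0 := by
  rintro rfl
  simp [IsIrred] at h

theorem dot_self_pos {e : ℤ × ℤ} (h : e ≠ 0) : 0 < dot e e := by
  have : e.1 ≠ 0 ∨ e.2 ≠ 0 := by
    by_contra! hc
    exact h (Prod.ext hc.1 hc.2)
  rcases this with h | h
  · have := mul_self_pos.2 h
    have := mul_self_nonneg e.2
    simp only [dot]; omega
  · have := mul_self_pos.2 h
    have := mul_self_nonneg e.1
    simp only [dot]; omega

theorem dot_self_nonneg (e : ℤ × ℤ) : 0 ≤ dot e e :=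
  add_nonneg (mul_self_nonneg _) (mul_self_nonneg _)

/-- An irreducible vector which is parallel to an irreducible vector is equal or opposite to it. -/
theorem IsIrred.eq_or_eq_neg {a e : ℤ × ℤ} (ha : IsIrred a) (he : IsIrred e)
    (h : cross a e = 0) : a = e ∨ a = -e := by
  rw [isIrred_iff] at ha he
  obtain ⟨s, t, hst⟩ := he
  obtain ⟨s', t', hst'⟩ := ha
  obtain ⟨a1, a2⟩ := a
  obtain ⟨e1, e2⟩ := e
  simp only [cross] at *
  have h1 : a1 = (s * a1 + t * a2) * e1 := by linear_combination (-a1) * hst + t * h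
  have h2 : a2 = (s * a1 + t * a2) * e2 := by linear_combination (-a2) * hst - s * h
  set k := s * a1 + t * a2
  have hk : k * (s' * e1 + t' * e2) = 1 := by linear_combination hst' - s' * h1 - t' * h2
  rcases Int.isUnit_iff.1 (IsUnit.of_mul_eq_one _ hk) with h | h <;> rw [h] at h1 h2
  · left; simp [h1, h2]
  · right; simp [h1, h2]

/-- Unit vectors have no parents; the other irreducible vectors do. -/
theorem exists_isParents {e : ℤ × ℤ} (h : IsIrred e) (hu : 1 < dot e e) :
    ∃ f g, IsParents f g e := by
  have hcop := isIrred_iff.1 h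
  obtain ⟨a, b⟩ := e
  simp only [dot] at hu hcop
  have ha : a ≠ 0 := by
    rintro rfl
    have : IsUnit b := isCoprime_zero_left.1 hcop
    rcases Int.isUnit_iff.1 this with h | h <;> simp [h] at hu
  have hb : b ≠ 0 := by
    rintro rfl
    have : IsUnit a := isCoprime_zero_right.1 hcop
    rcases Int.isUnit_iff.1 this with h | h <;> simp [h] at hu
  obtain ⟨p₁, q₁, p₂, q₂, h1, h2, h3, h4, h5, h6, h7⟩ :=
    exists_split_of_isCoprime (p := |a|) (q := |b|) (by have := abs_pos.2 ha; omega)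
      (by have := abs_pos.2 hb; omega) (by
        rw [Int.isCoprime_iff_gcd_eq_one] at *
        simpa [Int.gcd, Int.natAbs_abs] using hcop)
  have hd : 0 ≤ p₁ * p₂ + q₁ * q₂ := by positivity
  -- The splitting of `(|a|, |b|)` is reflected to the quadrant of `(a, b)`. When `s * t = -1` the
  -- orientation is reversed and the parents are exchanged.
  have hgen : ∀ s t : ℤ, a = s * |a| → b = t * |b| → s * s = 1 → t * t = 1 →
      ∃ f g, IsParents f g (a, b) := by
    intro s t hs ht hss htt
    have hst : (s * t) * (s * t) = 1 := by linear_combination t * t * hss + htt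
    have : (s * t - 1) * (s * t + 1) = 0 := by linear_combination hst
    rcases mul_eq_zero.1 this with h | h
    · refine ⟨(s * p₁, t * q₁), (s * p₂, t * q₂), ?_, ?_, ?_⟩
      · simp only; linear_combination (p₁ * q₂ - p₂ * q₁) * h + h7
      · have : s * p₁ * (s * p₂) + t * q₁ * (t * q₂) = p₁ * p₂ + q₁ * q₂ := by
          linear_combination p₁ * p₂ * hss + q₁ * q₂ * htt
        simp only [this, hd]
      · ext
        · simp only [Prod.fst_add]; linear_combination hs + s * h5
        · simp only [Prod.snd_add]; linear_combination ht + t * h6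
    · refine ⟨(s * p₂, t * q₂), (s * p₁, t * q₁), ?_, ?_, ?_⟩
      · simp only; linear_combination (p₂ * q₁ - p₁ * q₂) * h + h7
      · have : s * p₂ * (s * p₁) + t * q₂ * (t * q₁) = p₁ * p₂ + q₁ * q₂ := by
          linear_combination p₁ * p₂ * hss + q₁ * q₂ * htt
        simp only [this, hd]
      · ext
        · simp only [Prod.fst_add]; linear_combination hs + s * h5
        · simp only [Prod.snd_add]; linear_combination ht + t * h6
  refine hgen (SignType.sign a) (SignType.sign b) (sign_mul_abs a).symm (sign_mul_abs b).symm ?_ ?_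
  · rcases lt_or_gt_of_ne ha with h | h <;> simp [h]
  · rcases lt_or_gt_of_ne hb with h | h <;> simp [h]

theorem IsParents.cross_eq {f g e : ℤ × ℤ} (h : IsParents f g e) : cross f g = 1 := h.1

theorem IsParents.dot_nonneg {f g e : ℤ × ℤ} (h : IsParents f g e) : 0 ≤ dot f g := h.2.1

theorem IsParents.eq_add {f g e : ℤ × ℤ} (h : IsParents f g e) : e = f + g := h.2.2

theorem IsParents.neg {f g e : ℤ × ℤ} (h : IsParents f g e) : IsParents (-f) (-g) (-e) := by
  obtain ⟨h1, h2, rfl⟩ := h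
  refine ⟨?_, ?_, by abel⟩ <;> simp only [Prod.fst_neg, Prod.snd_neg, neg_mul_neg, h1, h2]

theorem IsParents.dot_left_lt {f g e : ℤ × ℤ} (h : IsParents f g e) : dot f f < dot e e := by
  have h2 := h.dot_nonneg
  have h3 := dot_self_pos (isIrred_right_of_cross h.cross_eq).ne_zero
  rw [h.eq_add]
  simp only [dot, Prod.fst_add, Prod.snd_add] at *
  nlinarith

theorem IsParents.dot_right_lt {f g e : ℤ × ℤ} (h : IsParents f g e) : dot g g < dot e e := by
  have h2 := h.dot_nonneg
  have h3 := dot_self_pos (isIrred_left_of_cross h.cross_eq).ne_zero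
  rw [h.eq_add]
  simp only [dot, Prod.fst_add, Prod.snd_add] at *
  nlinarith

theorem IsParents.isIrred {f g e : ℤ × ℤ} (h : IsParents f g e) : IsIrred e := by
  refine isIrred_right_of_cross (a := f) ?_
  have := h.1
  rw [h.eq_add]
  simp only [cross, Prod.fst_add, Prod.snd_add]
  linarith

/-- Of the parents of a vector, either both are unit vectors, or one is a parent of the other. -/
theorem IsParents.trichotomy {f g e : ℤ × ℤ} (h : IsParents f g e) :
    (dot f f = 1 ∧ dot g g = 1) ∨ IsParents (f - g) g f ∨ IsParents f (g - f) g := by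
  have h1 := h.cross_eq
  have h2 := h.dot_nonneg
  have hf := dot_self_pos (isIrred_left_of_cross h1).ne_zero
  have hg := dot_self_pos (isIrred_right_of_cross h1).ne_zero
  -- Lagrange's identity: if `d = dot f g` is smaller than both squared norms, then `(d + 1)² ≤ 1 +
  -- d²`, so `d = 0` and both norms are `1`.
  have key : dot f f * dot g g = 1 + dot f g * dot f g := by
    have : dot f f * dot g g = cross f g * cross f g + dot f g * dot f g := by
      simp only [dot, cross]; ring
    rw [this, h1]; ring
  by_cases hA : dot g g ≤ dot f g
  · right; left
    refine ⟨?_, ?_, by abel⟩ <;> simp only [cross, dot, Prod.fst_sub, Prod.snd_sub] at * <;> linarith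
  by_cases hB : dot f f ≤ dot f g
  · right; right
    refine ⟨?_, ?_, by abel⟩ <;> simp only [cross, dot, Prod.fst_sub, Prod.snd_sub] at * <;> linarith
  left
  have : (dot f g + 1) * (dot f g + 1) ≤ dot f f * dot g g :=
    mul_le_mul (by omega) (by omega) (by omega) (by omega)
  have h0 : dot f g = 0 := by nlinarith
  rw [h0] at key
  have h3 : IsUnit (dot f f) := IsUnit.of_mul_eq_one (dot g g) (by simpa using key)
  rcases Int.isUnit_iff.1 h3 with h4 | h4
  · rw [h4] at key; exact ⟨h4, by linarith⟩
  · omega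

/-! ### Integer points of convex sets -/

/-- A point with rational barycentric coordinates with respect to three points of a convex set. -/
theorem toPlane_mem_of_convex {C : Set (ℝ × ℝ)} (hC : Convex ℝ C) {a b c z : ℤ × ℤ} {i j k n : ℤ}
    (ha : toPlane a ∈ C) (hb : toPlane b ∈ C) (hc : toPlane c ∈ C)
    (hi : 0 ≤ i) (hj : 0 ≤ j) (hk : 0 ≤ k) (hn : 0 < n) (hs : i + j + k = n)
    (h1 : n * z.1 = i * a.1 + j * b.1 + k * c.1) (h2 : n * z.2 = i * a.2 + j * b.2 + k * c.2) :
    toPlane z ∈ C := by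
  have hn' : (0 : ℝ) < n := by exact_mod_cast hn
  have h := hC.sum_mem (t := Finset.univ) (w := ![(i : ℝ) / n, j / n, k / n])
    (z := ![toPlane a, toPlane b, toPlane c]) ?_ ?_ ?_
  · convert h using 1
    have h1' : (n : ℝ) * z.1 = i * a.1 + j * b.1 + k * c.1 := by exact_mod_cast h1
    have h2' : (n : ℝ) * z.2 = i * a.2 + j * b.2 + k * c.2 := by exact_mod_cast h2
    simp only [Fin.sum_univ_three]
    ext
    · simp [toPlane]; field_simp; linarith
    · simp [toPlane]; field_simp; linarith
  · have hi' : (0 : ℝ) ≤ i := by exact_mod_cast hi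
    have hj' : (0 : ℝ) ≤ j := by exact_mod_cast hj
    have hk' : (0 : ℝ) ≤ k := by exact_mod_cast hk
    intro m _
    fin_cases m <;> simp <;> positivity
  · simp only [Fin.sum_univ_three]
    have hs' : (i : ℝ) + j + k = n := by exact_mod_cast hs
    simp; field_simp; linarith
  · intro m _
    fin_cases m <;> simpa

/-- A set of integer points which contains the integer points of its convex hull. -/
def LatticeConvex (X : Set (ℤ × ℤ)) : Prop := ∀ z, toPlane z ∈ hull X → z ∈ X

theorem latticeConvex_gridPoints {Ω : Set (ℝ × ℝ)} (hΩ : Convex ℝ Ω) :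
    LatticeConvex (gridPoints Ω) := by
  intro z hz
  refine convexHull_min ?_ hΩ hz
  rintro _ ⟨y, hy, rfl⟩
  exact hy

theorem toPlane_mem_hull {X : Set (ℤ × ℤ)} {z : ℤ × ℤ} (hz : z ∈ X) : toPlane z ∈ hull X :=
  subset_convexHull ℝ _ ⟨z, hz, rfl⟩

theorem finite_gridPoints {Ω : Set (ℝ × ℝ)} (hΩ : IsCompact Ω) : (gridPoints Ω).Finite := by
  obtain ⟨R, hR⟩ := hΩ.isBounded.exists_norm_le
  refine Set.Finite.subset (Set.finite_Icc ((-⌈R⌉, -⌈R⌉) : ℤ × ℤ) (⌈R⌉, ⌈R⌉)) ?_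
  intro z hz
  have h := hR _ hz
  simp only [toPlane, Prod.norm_def, Real.norm_eq_abs, sup_le_iff, abs_le] at h
  have hc := Int.le_ceil R
  have h' : -(⌈R⌉ : ℝ) ≤ z.1 ∧ -(⌈R⌉ : ℝ) ≤ z.2 ∧ (z.1 : ℝ) ≤ ⌈R⌉ ∧ (z.2 : ℝ) ≤ ⌈R⌉ :=
    ⟨by linarith, by linarith, by linarith, by linarith⟩
  exact_mod_cast (⟨⟨h'.1, h'.2.1⟩, h'.2.2.1, h'.2.2.2⟩ :
    (-(⌈R⌉ : ℝ) ≤ z.1 ∧ -(⌈R⌉ : ℝ) ≤ z.2) ∧ (z.1 : ℝ) ≤ ⌈R⌉ ∧ (z.2 : ℝ) ≤ ⌈R⌉)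

/-- The three point criterion, with offsets from a point of the set. -/
theorem LatticeConvex.add_mem {X : Set (ℤ × ℤ)} (hX : LatticeConvex X) {x a b z : ℤ × ℤ}
    {j k n : ℤ} (hx : x ∈ X) (ha : x + a ∈ X) (hb : x + b ∈ X) (hj : 0 ≤ j) (hk : 0 ≤ k)
    (hn : 0 < n) (hs : j + k ≤ n) (h1 : n * z.1 = j * a.1 + k * b.1)
    (h2 : n * z.2 = j * a.2 + k * b.2) : x + z ∈ X := by
  refine hX _ (toPlane_mem_of_convex (convex_convexHull ℝ _) (toPlane_mem_hull hx)
    (toPlane_mem_hull ha) (toPlane_mem_hull hb) (i := n - j - k) (by omega) hj hk hn (by ring)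
    ?_ ?_)
  · simp only [Prod.fst_add]; linear_combination h1
  · simp only [Prod.snd_add]; linear_combination h2

/-! ### Stencils -/

section Stencils

variable {X : Set (ℤ × ℤ)}

theorem Stencils.isIrred (V : Stencils X) {x : X} {e : ℤ × ℤ} (h : e ∈ V.at' x) : IsIrred e :=
  (V.subset_max x h).1

theorem Stencils.add_mem (V : Stencils X) {x : X} {e : ℤ × ℤ} (h : e ∈ V.at' x) :
    (x : ℤ × ℤ) + e ∈ X := (V.subset_max x h).2

/-- A stencil which contains a vector strictly inside of the cone of an acute basis `(f, e)`
contains `e`. -/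
theorem Stencils.mem_of_descendant (hX : LatticeConvex X) (V : Stencils X) (x : X)
    {e f : ℤ × ℤ} (hfe : cross f e = 1 ∨ cross f e = -1) (hdot : 0 ≤ dot f e)
    (he : (x : ℤ × ℤ) + e ∈ X) (p q : ℤ) (hp : 1 ≤ p) (hq : 1 ≤ q) (a : ℤ × ℤ)
    (ha : a = p • f + q • e) (hav : a ∈ V.at' x) : e ∈ V.at' x := by
  obtain ⟨n, hn⟩ : ∃ n : ℕ, p ≤ n := ⟨p.toNat, Int.self_le_toNat p⟩
  induction n generalizing p q a with
  | zero => push_cast at hn; omega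
  | succ n ih =>
    have hcop : IsCoprime p q := by
      obtain ⟨s, t, hst⟩ := isIrred_iff.1 (V.isIrred hav)
      refine ⟨s * f.1 + t * f.2, s * e.1 + t * e.2, ?_⟩
      rw [ha] at hst
      simp only [Prod.fst_add, Prod.snd_add, Prod.smul_fst, Prod.smul_snd, smul_eq_mul] at hst
      linear_combination hst
    -- One step of the descent: `c` and `d` are the parents of `a`, in an order given by the
    -- orientation, and `d` is the one nearer to `e`. From `p • d = p₂ • a + e` it lies in the
    -- triangle `0, a, e`, so stability applies. The descent continues since `p₂ < p`, and stops at
    -- `d = e`.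
    obtain ⟨p₁, q₁, p₂, q₂, h1, h2, h3, h4, h5, h6, h7⟩ := exists_split_of_isCoprime hp hq hcop
    set d := p₂ • f + q₂ • e with hd
    set c := p₁ • f + q₁ • e with hc
    have hcd : 0 ≤ dot c d := by
      have : dot c d = p₁ * p₂ * dot f f + (p₁ * q₂ + p₂ * q₁) * dot f e + q₁ * q₂ * dot e e := by
        simp only [hc, hd, dot, Prod.fst_add, Prod.snd_add, Prod.smul_fst, Prod.smul_snd,
          smul_eq_mul]
        ring
      have hff : 0 ≤ dot f f := dot_self_nonneg f
      have hee : 0 ≤ dot e e := dot_self_nonneg e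
      rw [this]; positivity
    have hcr : cross c d = cross f e := by
      have : cross c d = (p₁ * q₂ - p₂ * q₁) * cross f e := by
        simp only [hc, hd, cross, Prod.fst_add, Prod.snd_add, Prod.smul_fst, Prod.smul_snd,
          smul_eq_mul]
        ring
      rw [this, h7, one_mul]
    have hacd : a = c + d := by rw [ha, hc, hd, h5, h6]; module
    have hdX : (x : ℤ × ℤ) + d ∈ X := by
      refine hX.add_mem (n := p) (j := p₂) (k := 1) x.2 (V.add_mem hav) he h3 zero_le_one
        (by omega) (by omega) ?_ ?_
      · rw [ha, hd]
        simp only [Prod.fst_add, Prod.smul_fst, smul_eq_mul]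
        rw [h5, h6]; linear_combination e.1 * h7
      · rw [ha, hd]
        simp only [Prod.snd_add, Prod.smul_snd, smul_eq_mul]
        rw [h5, h6]; linear_combination e.2 * h7
    have hdV : d ∈ V.at' x := by
      rcases hfe with h | h
      · have hpar : IsParents c d a := ⟨hcr.trans h, hcd, hacd⟩
        exact (V.stability x a c d hav hpar).2 ⟨isIrred_right_of_cross hpar.cross_eq, hdX⟩
      · have hpar : IsParents d c a := by
          refine ⟨?_, ?_, by rw [hacd, add_comm]⟩
          · have := hcr.trans h; simp only [cross] at this; linarith
          · simp only [dot] at hcd; linarith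
        exact (V.stability x a d c hav hpar).1 ⟨isIrred_left_of_cross hpar.cross_eq, hdX⟩
    by_cases hp2 : p₂ = 0
    · have : q₂ = 1 := by
        rw [hp2] at h7
        have h8 : p₁ * q₂ = 1 := by linarith
        rcases Int.eq_one_or_neg_one_of_mul_eq_one' h8 with h | h <;> omega
      rw [hd, hp2, this] at hdV
      simpa using hdV
    · exact ih p₂ q₂ (by omega) h4 d hd hdV (by push_cast at hn; omega)

/-- A linear form which is nonpositive on a stencil is nonpositive on the maximal stencil. -/
theorem Stencils.nonpos_of_nonpos (V : Stencils X) (x : X) (s t : ℤ)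
    (h : ∀ a ∈ V.at' x, s * a.1 + t * a.2 ≤ 0) {e : ℤ × ℤ} (he : e ∈ maxStencil X x) :
    s * e.1 + t * e.2 ≤ 0 := by
  have hmem : toPlane e ∈ cone (V.at' x) := by
    rw [V.visibility x]
    exact Submodule.subset_span ⟨e, he, rfl⟩
  have key : ∀ y ∈ cone (V.at' x), (s : ℝ) * y.1 + t * y.2 ≤ 0 := by
    intro y hy
    refine Submodule.span_induction (p := fun y _ => (s : ℝ) * y.1 + t * y.2 ≤ 0) ?_ ?_ ?_ ?_ hy
    · rintro _ ⟨a, ha, rfl⟩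
      simp only [toPlane]
      exact_mod_cast h a ha
    · simp
    · intro y z _ _ hy hz
      simp only [Prod.fst_add, Prod.snd_add]; linarith
    · intro c y _ hy
      have : (c • y) = (c : ℝ) • y := rfl
      simp only [this, Prod.smul_fst, Prod.smul_snd, smul_eq_mul]
      have := mul_nonpos_of_nonneg_of_nonpos c.2 hy
      linarith
  have := key _ hmem
  simp only [toPlane] at this
  exact_mod_cast this

/-- Unit vectors of the maximal stencil belong to all stencils. -/
theorem Stencils.mem_of_dot_eq_one (hX : LatticeConvex X) (V : Stencils X) (x : X) {e : ℤ × ℤ}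
    (he : e ∈ maxStencil X x) (hu : dot e e = 1) : e ∈ V.at' x := by
  by_contra hne
  -- The form `dot e` is `1` at `e`, so by visibility it is positive at some element of the stencil.
  -- Such an element is `e` or lies strictly between `e` and a unit vector orthogonal to it.
  have := V.nonpos_of_nonpos x e.1 e.2 ?_ he
  · simp only [dot] at hu; omega
  intro a ha
  by_contra! hpos
  -- Coordinates in an orthonormal basis containing `e`; `σ` chooses the normal along which `a` has
  -- a positive coordinate.
  have hdec : ∀ σ : ℤ, σ * σ = 1 → a = (σ * cross a e) • (σ * e.2, - σ * e.1) + dot e a • e := by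
    intro σ hσ
    simp only [dot, cross] at *
    ext
    · simp only [Prod.fst_add, Prod.smul_fst, smul_eq_mul]
      linear_combination (-a.1 * hu) + (a.2 * e.1 * e.2 - e.2 * e.2 * a.1) * hσ
    · simp only [Prod.snd_add, Prod.smul_snd, smul_eq_mul]
      linear_combination (-a.2 * hu) + (a.1 * e.1 * e.2 - e.1 * e.1 * a.2) * hσ
  have h1 : 1 ≤ dot e a := by simp only [dot]; omega
  simp only [dot] at hu
  rcases lt_trichotomy (cross a e) 0 with h | h | h
  · exact hne (V.mem_of_descendant hX x (f := (-1 * e.2, - -1 * e.1))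
      (Or.inr (by simp only [cross]; linarith)) (by simp only [dot]; linarith) he.2 _ _
      (by linarith) h1 a (hdec (-1) (by norm_num)) ha)
  · rcases (V.isIrred ha).eq_or_eq_neg he.1 h with rfl | rfl
    · exact hne ha
    · simp only [Prod.fst_neg, Prod.snd_neg] at hpos; nlinarith
  · exact hne (V.mem_of_descendant hX x (f := (1 * e.2, - 1 * e.1))
      (Or.inl (by simp only [cross]; linarith)) (by simp only [dot]; linarith) he.2 _ _
      (by linarith) h1 a (hdec 1 (by norm_num)) ha)

/-- Elements of a stencil are not strictly inside of the cone of the parents of a vector outside of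
the stencil. -/
theorem Stencils.not_descendant (hX : LatticeConvex X) (V : Stencils X) (x : X) {e f g : ℤ × ℤ}
    (he : (x : ℤ × ℤ) + e ∈ X) (hne : e ∉ V.at' x) (hp : IsParents f g e) {a : ℤ × ℤ}
    (ha : a ∈ V.at' x) : cross a g ≤ 0 ∨ cross f a ≤ 0 := by
  by_contra! hc
  obtain ⟨h1, h2⟩ := hc
  have h3 := hp.cross_eq
  have h4 := hp.dot_nonneg
  have hff : 0 ≤ dot f f := dot_self_nonneg f
  have hgg : 0 ≤ dot g g := dot_self_nonneg g
  have hdec : a = cross a g • f + cross f a • g := by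
    simp only [cross] at *
    ext
    · simp only [Prod.fst_add, Prod.smul_fst, smul_eq_mul]
      linear_combination -a.1 * h3
    · simp only [Prod.snd_add, Prod.smul_snd, smul_eq_mul]
      linear_combination -a.2 * h3
  have hefg := hp.eq_add
  -- The mediant `e` divides the cone of `f, g` into two unimodular acute cones; the descent applies
  -- in whichever contains `a`.
  rcases lt_trichotomy (cross a g) (cross f a) with h | h | h
  · refine hne (V.mem_of_descendant hX x (f := g) (Or.inr ?_) ?_ he (cross f a - cross a g)
      (cross a g) (by omega) (by omega) a ?_ ha)
    · rw [hefg]; simp only [cross, Prod.fst_add, Prod.snd_add] at *; linarith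
    · rw [hefg]; simp only [dot, Prod.fst_add, Prod.snd_add] at *; linarith
    · rw [hefg]; nth_rewrite 1 [hdec]; module
  · have hirr := V.isIrred ha
    rw [hdec, ← h, ← smul_add, ← hefg] at hirr
    have h5 : cross a g ∣ 1 := by
      obtain ⟨s, t, hst⟩ := isIrred_iff.1 hirr
      simp only [Prod.smul_fst, Prod.smul_snd, smul_eq_mul] at hst
      exact ⟨s * e.1 + t * e.2, by linear_combination -hst⟩
    have h6 : cross a g = 1 := Int.eq_one_of_dvd_one h1.le h5
    rw [hdec, ← h, h6, one_smul, one_smul, ← hefg] at ha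
    exact hne ha
  · refine hne (V.mem_of_descendant hX x (f := f) (Or.inl ?_) ?_ he (cross a g - cross f a)
      (cross f a) (by omega) (by omega) a ?_ ha)
    · rw [hefg]; simp only [cross, Prod.fst_add, Prod.snd_add] at *; linarith
    · rw [hefg]; simp only [dot, Prod.fst_add, Prod.snd_add] at *; linarith
    · rw [hefg]; nth_rewrite 1 [hdec]; module

theorem Stencils.finite (hXf : X.Finite) (V : Stencils X) (x : X) : (V.at' x).Finite := by
  refine (hXf.preimage (f := fun e => (x : ℤ × ℤ) + e) ?_).subset fun e he => V.add_mem he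
  exact (add_right_injective _).injOn

/-- A vector outside of a stencil is strictly inside of the cone generated by two of its
elements. -/
theorem Stencils.exists_pair (hXf : X.Finite) (V : Stencils X) (x : X) {e : ℤ × ℤ}
    (he : e ∈ maxStencil X x) (hne : e ∉ V.at' x) :
    ∃ a ∈ V.at' x, ∃ b ∈ V.at' x, 0 < cross a e ∧ 0 < cross e b ∧ 0 < cross a b := by
  by_contra! hc
  have hpos := dot_self_pos he.1.ne_zero
  have hpar : ∀ v ∈ V.at' x, cross v e = 0 → v = -e := fun v hv h =>
    ((V.isIrred hv).eq_or_eq_neg he.1 h).resolve_left fun h => hne (h ▸ hv)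
  by_cases hR : {a ∈ V.at' x | 0 < cross a e}.Nonempty
  -- Maximal cotangent means smallest angle with `e` among the elements clockwise from it. Without a
  -- partner `b`, the form `cross a` separates `e` from the stencil.
  · obtain ⟨a, ⟨ha, hae⟩, hmax⟩ := ((V.finite hXf x).subset (Set.sep_subset _ _)).exists_maximalFor
      (fun a => (dot a e : ℚ) / cross a e) _ hR
    have := V.nonpos_of_nonpos x (-a.2) a.1 ?_ he
    · simp only [cross] at hae; linarith
    intro v hv
    suffices cross a v ≤ 0 by simp only [cross] at this; linarith
    rcases lt_trichotomy (cross v e) 0 with h | h | h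
    · exact hc a ha v hv hae (by simp only [cross] at *; linarith)
    · rw [hpar v hv h]
      simp only [cross, Prod.fst_neg, Prod.snd_neg] at *; linarith
    · have hle : (dot v e : ℚ) / cross v e ≤ (dot a e : ℚ) / cross a e := by
        rcases le_total ((dot v e : ℚ) / cross v e) ((dot a e : ℚ) / cross a e) with h' | h'
        · exact h'
        · exact hmax ⟨hv, h⟩ h'
      rw [div_le_div_iff₀ (by exact_mod_cast h) (by exact_mod_cast hae)] at hle
      have hle' : dot v e * cross a e ≤ dot a e * cross v e := by exact_mod_cast hle
      have hid : cross a v * dot e e = dot v e * cross a e - dot a e * cross v e := by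
        simp only [cross, dot]; ring
      by_contra! hlt
      have := mul_pos hlt hpos
      linarith
  -- Here every element is counterclockwise from `e` or equal to `-e`. As a nonzero determinant is
  -- at least `1`, subtracting a large multiple of `cross e` from `dot e` gives a separating form.
  · obtain ⟨N, hN⟩ := ((V.finite hXf x).image (dot e)).bddAbove
    have := V.nonpos_of_nonpos x (e.1 + max N 0 * e.2) (e.2 - max N 0 * e.1) ?_ he
    · simp only [dot] at hpos; linarith
    intro v hv
    have hvN : dot e v ≤ max N 0 := (hN ⟨v, hv, rfl⟩).trans (le_max_left _ _)
    have hN0 : 0 ≤ max N 0 := le_max_right _ _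
    suffices dot e v - max N 0 * cross e v ≤ 0 by simp only [cross, dot] at this; linarith
    rcases lt_trichotomy (cross e v) 0 with h | h | h
    · exact absurd ⟨v, hv, by simp only [cross] at *; linarith⟩ hR
    · rw [h, hpar v hv (by simp only [cross] at *; linarith)]
      simp only [dot, Prod.fst_neg, Prod.snd_neg] at *; linarith
    · nlinarith

/-- The parents of a vector outside of a stencil belong to the maximal stencil. -/
theorem Stencils.parents_mem (hX : LatticeConvex X) (hXf : X.Finite) (V : Stencils X) (x : X)
    {e f g : ℤ × ℤ} (he : e ∈ maxStencil X x) (hne : e ∉ V.at' x) (hp : IsParents f g e) :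
    f ∈ maxStencil X x ∧ g ∈ maxStencil X x := by
  -- Neither `a` nor `b` is strictly between `f` and `g`, so this pair encloses them along with `e`.
  -- Then `f` is in the triangle `0, a, e` and `g` in the triangle `0, e, b`.
  obtain ⟨a, ha, b, hb, hae, heb, hab⟩ := V.exists_pair hXf x he hne
  have h1 := V.not_descendant hX x he.2 hne hp ha
  have h2 := V.not_descendant hX x he.2 hne hp hb
  have hfg := hp.cross_eq
  have hefg := hp.eq_add
  have hae' : cross a e = cross a f + cross a g := by
    rw [hefg]; simp only [cross, Prod.fst_add, Prod.snd_add]; ring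
  have heb' : cross e b = cross f b + cross g b := by
    rw [hefg]; simp only [cross, Prod.fst_add, Prod.snd_add]; ring
  have hfa : cross f a = - cross a f := by simp only [cross]; ring
  have hbg : cross b g = - cross g b := by simp only [cross]; ring
  have hid : cross a b = cross a g * cross f b - cross a f * cross g b := by
    have : cross a b = cross a b * cross f g := by rw [hfg, mul_one]
    rw [this]; simp only [cross]; ring
  have haf : 0 ≤ cross a f := by
    by_contra! hlt
    rcases h1 with h | h <;> omega
  have hgb : 0 ≤ cross g b := by
    by_contra! hlt
    rcases h2 with h | h <;> omega
  have hag : 1 ≤ cross a g := by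
    by_contra! hlt
    have : cross a f * cross g b ≥ 0 := mul_nonneg haf hgb
    by_cases hfb : 0 ≤ cross f b
    · nlinarith
    · nlinarith
  have hfb : 1 ≤ cross f b := by
    by_contra! hlt
    have : cross a f * cross g b ≥ 0 := mul_nonneg haf hgb
    nlinarith
  constructor
  -- The coefficient of `a` is `cross f e = cross f g = 1`.
  · refine ⟨isIrred_left_of_cross hfg, hX.add_mem (n := cross a e) (j := 1) (k := cross a f) x.2
      (V.add_mem ha) he.2 zero_le_one haf hae (by omega) ?_ ?_⟩
    · rw [hefg]; simp only [cross, Prod.fst_add, Prod.snd_add] at *; linear_combination a.1 * hfg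
    · rw [hefg]; simp only [cross, Prod.fst_add, Prod.snd_add] at *; linear_combination a.2 * hfg
  · refine ⟨isIrred_right_of_cross hfg, hX.add_mem (n := cross e b) (j := 1) (k := cross g b) x.2
      (V.add_mem hb) he.2 zero_le_one hgb heb (by omega) ?_ ?_⟩
    · rw [hefg]; simp only [cross, Prod.fst_add, Prod.snd_add] at *; linear_combination b.1 * hfg
    · rw [hefg]; simp only [cross, Prod.fst_add, Prod.snd_add] at *; linear_combination b.2 * hfg

end Stencils

/-! ### The linear forms -/

section Forms

variable {X : Set (ℤ × ℤ)}

theorem extend_apply (u : X → ℝ) (x : X) : extend u x = u x :=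
  Subtype.val_injective.extend_apply u 0 x

theorem extend_of_mem (u : X → ℝ) {z : ℤ × ℤ} (hz : z ∈ X) : extend u z = u ⟨z, hz⟩ :=
  extend_apply u ⟨z, hz⟩

theorem extend_of_notMem (u : X → ℝ) {z : ℤ × ℤ} (hz : z ∉ X) : extend u z = 0 :=
  Function.extend_apply' _ _ _ fun ⟨x, hx⟩ => hz (hx ▸ x.2)

theorem extend_add_smul (u v : X → ℝ) (t : ℝ) : extend (u + t • v) = extend u + t • extend v := by
  funext z
  by_cases hz : z ∈ X
  · simp [extend_of_mem _ hz]
  · simp [extend_of_notMem _ hz]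

theorem continuous_extend (z : ℤ × ℤ) : Continuous fun u : X → ℝ => extend u z := by
  by_cases hz : z ∈ X
  · simp only [extend_of_mem _ hz]; fun_prop
  · simp only [extend_of_notMem _ hz]; fun_prop

theorem formS_add_smul (x e : ℤ × ℤ) (u v : ℤ × ℤ → ℝ) (t : ℝ) :
    formS x e (u + t • v) = formS x e u + t * formS x e v := by
  simp only [formS, Pi.add_apply, Pi.smul_apply, smul_eq_mul]; ring

theorem formT_add_smul (x e f g : ℤ × ℤ) (u v : ℤ × ℤ → ℝ) (t : ℝ) :
    formT x e f g (u + t • v) = formT x e f g u + t * formT x e f g v := by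
  simp only [formT, Pi.add_apply, Pi.smul_apply, smul_eq_mul]; ring

theorem formP_add_smul (x e f g : ℤ × ℤ) (u v : ℤ × ℤ → ℝ) (t : ℝ) :
    formP x e f g (u + t • v) = formP x e f g u + t * formP x e f g v := by
  simp only [formP, Pi.add_apply, Pi.smul_apply, smul_eq_mul]; ring

/-- Along `Conv(V)` the segment forms are nonnegative in all directions, and the parallelogram forms
are nonnegative in all directions outside of the stencil. -/
theorem formS_nonneg_and_formP_nonneg (hX : LatticeConvex X) (hXf : X.Finite) (V : Stencils X)
    {u : X → ℝ} (hu : u ∈ convStencils V) (N : ℕ) (e : ℤ × ℤ) (heN : dot e e < N)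
    (he : IsIrred e) :
    (∀ x ∈ X, x + e ∈ X → x - e ∈ X → 0 ≤ formS x e (extend u)) ∧
    (∀ x : X, (x : ℤ × ℤ) + e ∈ X → e ∉ V.at' x → ∀ f g, IsParents f g e →
      0 ≤ formP x e f g (extend u)) := by
  induction N generalizing e with
  | zero =>
    have := dot_self_nonneg e
    push_cast at heN; omega
  | succ N ih =>
    have hP : ∀ e, dot e e < (N + 1 : ℕ) → IsIrred e → ∀ x : X, (x : ℤ × ℤ) + e ∈ X →
        e ∉ V.at' x → ∀ f g, IsParents f g e → 0 ≤ formP x e f g (extend u) := by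
      intro e heN he x hxe hne f g hp
      have hfN : dot f f < N := by have := hp.dot_left_lt; push_cast at heN; omega
      have hgN : dot g g < N := by have := hp.dot_right_lt; push_cast at heN; omega
      obtain ⟨hf, hg⟩ := V.parents_mem hX hXf x ⟨he, hxe⟩ hne hp
      by_cases hboth : f ∈ V.at' x ∧ g ∈ V.at' x
      · exact (hu x).2.2 e ⟨he, hxe⟩ hne f g hp hboth.1 hboth.2
      rcases hp.trichotomy with ⟨h1, h2⟩ | h | h
      · exact absurd ⟨V.mem_of_dot_eq_one hX x hf h1, V.mem_of_dot_eq_one hX x hg h2⟩ hboth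
      -- The parents of `f` are `f - g` and `g`, and `P_x^e = P_x^f + S_{x+f}^g`. The other case is
      -- symmetric.
      · have hfV : f ∉ V.at' x := fun hf => hboth ⟨hf, (V.stability x f _ g hf h).2 hg⟩
        have h1 := (ih f hfN hf.1).2 x hf.2 hfV _ _ h
        have hk := V.parents_mem hX hXf x hf hfV h
        have h2 := (ih g hgN hg.1).1 (x + f) hf.2 (by rw [add_assoc, ← hp.eq_add]; exact hxe)
          (by rw [add_sub_assoc]; exact hk.1.2)
        have e1 : (x : ℤ × ℤ) + f + g = x + e := by rw [hp.eq_add, add_assoc]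
        have e2 : (x : ℤ × ℤ) + f - g = x + (f - g) := by rw [add_sub_assoc]
        simp only [formP, formS, e1, e2] at *
        linarith
      · have hgV : g ∉ V.at' x := fun hg => hboth ⟨(V.stability x g f _ hg h).1 hf, hg⟩
        have h1 := (ih g hgN hg.1).2 x hg.2 hgV _ _ h
        have hk := V.parents_mem hX hXf x hg hgV h
        have e1 : (x : ℤ × ℤ) + g + f = x + e := by rw [hp.eq_add]; abel
        have e2 : (x : ℤ × ℤ) + g - f = x + (g - f) := by rw [add_sub_assoc]
        have h2 := (ih f hfN hf.1).1 (x + g) hg.2 (by rw [e1]; exact hxe)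
          (by rw [e2]; exact hk.2.2)
        simp only [formP, formS, e1, e2] at *
        linarith
    refine ⟨fun x hx hxe hxe' => ?_, hP e heN he⟩
    by_cases h1 : e ∈ V.at' ⟨x, hx⟩
    · exact (hu ⟨x, hx⟩).1 e h1 hxe hxe'
    have hnee : x + -e ∈ X := by rwa [← sub_eq_add_neg]
    by_cases h2 : -e ∈ V.at' ⟨x, hx⟩
    · have := (hu ⟨x, hx⟩).1 (-e) h2 hnee (by simpa using hxe)
      simp only [formS, ← sub_eq_add_neg, sub_neg_eq_add] at *
      linarith
    have hgt : 1 < dot e e := by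
      have h3 := dot_self_pos he.ne_zero
      by_contra! h4
      exact h1 (V.mem_of_dot_eq_one hX ⟨x, hx⟩ ⟨he, hxe⟩ (by omega))
    obtain ⟨f, g, hp⟩ := exists_isParents he hgt
    have hfN : dot f f < N := by have := hp.dot_left_lt; push_cast at heN; omega
    have hgN : dot g g < N := by have := hp.dot_right_lt; push_cast at heN; omega
    obtain ⟨hf, hg⟩ := V.parents_mem hX hXf ⟨x, hx⟩ ⟨he, hxe⟩ h1 hp
    obtain ⟨hf', hg'⟩ := V.parents_mem hX hXf ⟨x, hx⟩ ⟨isIrred_neg he, hnee⟩ h2 hp.neg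
    -- The identity is `S_x^e = P_x^e + P_x^{-e} + S_x^f + S_x^g`.
    have i1 := hP e heN he ⟨x, hx⟩ hxe h1 f g hp
    have hneN : dot (-e) (-e) < (N + 1 : ℕ) := by simpa only [dot, Prod.fst_neg, Prod.snd_neg,
      neg_mul_neg] using heN
    have i2 := hP (-e) hneN (isIrred_neg he) ⟨x, hx⟩ hnee h2 _ _ hp.neg
    have i3 := (ih f hfN hf.1).1 x hx hf.2 (by rw [sub_eq_add_neg]; exact hf'.2)
    have i4 := (ih g hgN hg.1).1 x hx hg.2 (by rw [sub_eq_add_neg]; exact hg'.2)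
    simp only [formP, formS, ← sub_eq_add_neg] at *
    linarith

theorem formS_nonneg (hX : LatticeConvex X) (hXf : X.Finite) (V : Stencils X)
    {u : X → ℝ} (hu : u ∈ convStencils V) {x e : ℤ × ℤ} (he : IsIrred e) (hx : x ∈ X)
    (h1 : x + e ∈ X) (h2 : x - e ∈ X) : 0 ≤ formS x e (extend u) :=
  (formS_nonneg_and_formP_nonneg hX hXf V hu ((dot e e).toNat + 1) e
    (by push_cast; have := Int.self_le_toNat (dot e e); omega) he).1 x hx h1 h2

theorem formP_nonneg (hX : LatticeConvex X) (hXf : X.Finite) (V : Stencils X)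
    {u : X → ℝ} (hu : u ∈ convStencils V) {x : X} {e f g : ℤ × ℤ} (h1 : (x : ℤ × ℤ) + e ∈ X)
    (hne : e ∉ V.at' x) (hp : IsParents f g e) : 0 ≤ formP x e f g (extend u) :=
  (formS_nonneg_and_formP_nonneg hX hXf V hu ((dot e e).toNat + 1) e
    (by push_cast; have := Int.self_le_toNat (dot e e); omega) hp.isIrred).2 x h1 hne f g hp

/-- Outside the stencil this follows from `T_x^e = P_x^e + S_x^f + S_x^g`. -/
theorem formT_nonneg (hX : LatticeConvex X) (hXf : X.Finite) (V : Stencils X)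
    {u : X → ℝ} (hu : u ∈ convStencils V) {x e f g : ℤ × ℤ} (hp : IsParents f g e) (hx : x ∈ X)
    (h1 : x + e ∈ X) (h2 : x - f ∈ X) (h3 : x - g ∈ X) : 0 ≤ formT x e f g (extend u) := by
  by_cases heV : e ∈ V.at' ⟨x, hx⟩
  · exact (hu ⟨x, hx⟩).2.1 e heV f g hp h1 h2 h3
  obtain ⟨hf, hg⟩ := V.parents_mem hX hXf ⟨x, hx⟩ ⟨hp.isIrred, h1⟩ heV hp
  have i1 := formP_nonneg hX hXf V hu (x := ⟨x, hx⟩) h1 heV hp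
  have i2 := formS_nonneg hX hXf V hu hf.1 hx hf.2 h2
  have i3 := formS_nonneg hX hXf V hu hg.1 hx hg.2 h3
  simp only [formS, formT, formP] at *
  linarith

/-- A linear form which is nonnegative on a set is positive in its interior, unless it vanishes. -/
theorem pos_of_mem_interior {C : Set (X → ℝ)} {F : (ℤ × ℤ → ℝ) → ℝ}
    (hF : ∀ v w (t : ℝ), F (v + t • w) = F v + t * F w) (hC : ∀ u ∈ C, 0 ≤ F (extend u))
    {d : X → ℝ} (hd : F (extend d) < 0) {u : X → ℝ} (hu : u ∈ interior C) : 0 < F (extend u) := by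
  have hcont : Continuous fun t : ℝ => u + t • d := by fun_prop
  have h0 : ∀ᶠ t in nhds (0 : ℝ), u + t • d ∈ C := by
    have : Filter.Tendsto (fun t : ℝ => u + t • d) (nhds 0) (nhds u) := by
      simpa using hcont.tendsto 0
    exact this (mem_interior_iff_mem_nhds.1 hu)
  obtain ⟨ε, hε, hball⟩ := Metric.eventually_nhds_iff.1 h0
  have h1 := hC _ (hball (y := ε / 2) (by simp [abs_of_pos hε, hε]))
  rw [extend_add_smul, hF] at h1
  nlinarith

theorem extend_neg_single [DecidableEq X] (y : X) (z : ℤ × ℤ) :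
    extend (-Pi.single y (1 : ℝ)) z = if z = y then -1 else 0 := by
  by_cases hz : z ∈ X
  · rw [extend_of_mem _ hz, Pi.neg_apply, Pi.single_apply]
    by_cases h : z = y
    · simp [h]
    · have : (⟨z, hz⟩ : X) ≠ y := fun h' => h (congrArg Subtype.val h')
      simp [h, this]
  · rw [extend_of_notMem _ hz, if_neg]
    rintro rfl
    exact hz y.2

/-- The value at `x + e` enters with coefficient `1` and at no other place, so the form decreases
along minus the indicator of this point. The two other forms are treated in the same way. -/
theorem formS_pos (hX : LatticeConvex X) (hXf : X.Finite) (V : Stencils X)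
    {u : X → ℝ} (hu : u ∈ interior (convStencils V)) {x e : ℤ × ℤ} (he : IsIrred e) (hx : x ∈ X)
    (h1 : x + e ∈ X) (h2 : x - e ∈ X) : 0 < formS x e (extend u) := by
  classical
  refine pos_of_mem_interior (formS_add_smul x e)
    (fun u hu => formS_nonneg hX hXf V hu he hx h1 h2) (d := -Pi.single ⟨x + e, h1⟩ 1) ?_ hu
  have hne := he.ne_zero
  have h3 : x ≠ x + e := by simpa using hne
  have h4 : x - e ≠ x + e := by
    intro h
    have h5 : e.1 = 0 := by have := congrArg Prod.fst h; simp at this; omega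
    have h6 : e.2 = 0 := by have := congrArg Prod.snd h; simp at this; omega
    exact hne (Prod.ext h5 h6)
  simp [formS, extend_neg_single, h3, h4]

theorem formP_pos (hX : LatticeConvex X) (hXf : X.Finite) (V : Stencils X)
    {u : X → ℝ} (hu : u ∈ interior (convStencils V)) {x : X} {e f g : ℤ × ℤ}
    (h1 : (x : ℤ × ℤ) + e ∈ X) (hne : e ∉ V.at' x) (hp : IsParents f g e) :
    0 < formP x e f g (extend u) := by
  classical
  refine pos_of_mem_interior (formP_add_smul x e f g)
    (fun u hu => formP_nonneg hX hXf V hu h1 hne hp) (d := -Pi.single ⟨x + e, h1⟩ 1) ?_ hu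
  have hf := (isIrred_left_of_cross hp.cross_eq).ne_zero
  have hg := (isIrred_right_of_cross hp.cross_eq).ne_zero
  have h4 := hp.isIrred.ne_zero
  have h5 : f ≠ e := by rw [hp.eq_add]; simpa using hg
  have h6 : g ≠ e := by rw [hp.eq_add]; simpa using hf
  simp [formP, extend_neg_single, h4, h5, h6]

theorem formT_pos (hX : LatticeConvex X) (hXf : X.Finite) (V : Stencils X)
    {u : X → ℝ} (hu : u ∈ interior (convStencils V)) {x e f g : ℤ × ℤ} (hp : IsParents f g e)
    (hx : x ∈ X) (h1 : x + e ∈ X) (h2 : x - f ∈ X) (h3 : x - g ∈ X) :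
    0 < formT x e f g (extend u) := by
  classical
  refine pos_of_mem_interior (formT_add_smul x e f g)
    (fun u hu => formT_nonneg hX hXf V hu hp hx h1 h2 h3) (d := -Pi.single ⟨x + e, h1⟩ 1) ?_ hu
  have h4 := hp.isIrred.ne_zero
  have hff := dot_self_pos (isIrred_left_of_cross hp.cross_eq).ne_zero
  have hgg := dot_self_pos (isIrred_right_of_cross hp.cross_eq).ne_zero
  have hfg := hp.dot_nonneg
  have h5 : x - f ≠ x + e := by
    intro h
    have h6 : -f = e := by rw [sub_eq_add_neg] at h; exact add_left_cancel h
    have h7 : dot f e = dot f f + dot f g := by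
      rw [hp.eq_add]; simp only [dot, Prod.fst_add, Prod.snd_add]; ring
    rw [← h6] at h7
    simp only [dot, Prod.fst_neg, Prod.snd_neg] at *; linarith
  have h6 : x - g ≠ x + e := by
    intro h
    have h6 : -g = e := by rw [sub_eq_add_neg] at h; exact add_left_cancel h
    have h7 : dot g e = dot g g + dot f g := by
      rw [hp.eq_add]; simp only [dot, Prod.fst_add, Prod.snd_add]; ring
    rw [← h6] at h7
    simp only [dot, Prod.fst_neg, Prod.snd_neg] at *; linarith
  simp [formT, extend_neg_single, h4, h5, h6]

theorem isClosed_convStencils (V : Stencils X) : IsClosed (convStencils V) := by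
  have hS : ∀ x e : ℤ × ℤ, IsClosed {u : X → ℝ | 0 ≤ formS x e (extend u)} := fun x e =>
    isClosed_le continuous_const (((continuous_extend _).sub
      (continuous_const.mul (continuous_extend _))).add (continuous_extend _))
  have hT : ∀ x e f g : ℤ × ℤ, IsClosed {u : X → ℝ | 0 ≤ formT x e f g (extend u)} :=
    fun x e f g => isClosed_le continuous_const ((((continuous_extend _).add
      (continuous_extend _)).add (continuous_extend _)).sub
        (continuous_const.mul (continuous_extend _)))
  have hP : ∀ x e f g : ℤ × ℤ, IsClosed {u : X → ℝ | 0 ≤ formP x e f g (extend u)} :=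
    fun x e f g => isClosed_le continuous_const ((((continuous_extend _).sub
      (continuous_extend _)).sub (continuous_extend _)).add (continuous_extend _))
  simp only [convStencils, Set.ofPred_forall, Set.ofPred_and]
  refine isClosed_iInter fun x => (?_ : IsClosed _).inter ((?_ : IsClosed _).inter ?_)
  · exact isClosed_iInter fun _ => isClosed_iInter fun _ => isClosed_iInter fun _ =>
      isClosed_iInter fun _ => hS _ _
  · exact isClosed_iInter fun _ => isClosed_iInter fun _ => isClosed_iInter fun _ =>
      isClosed_iInter fun _ => isClosed_iInter fun _ => isClosed_iInter fun _ =>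
      isClosed_iInter fun _ => isClosed_iInter fun _ => hT _ _ _ _
  · exact isClosed_iInter fun _ => isClosed_iInter fun _ => isClosed_iInter fun _ =>
      isClosed_iInter fun _ => isClosed_iInter fun _ => isClosed_iInter fun _ =>
      isClosed_iInter fun _ => isClosed_iInter fun _ => hP _ _ _ _

theorem convex_convStencils (V : Stencils X) : Convex ℝ (convStencils V) := by
  intro u hu v hv a b ha hb _
  have hext : ∀ z, extend (a • u + b • v) z = a * extend u z + b * extend v z := by
    intro z
    by_cases hz : z ∈ X
    · simp [extend_of_mem _ hz]
    · simp [extend_of_notMem _ hz]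
  intro x
  refine ⟨fun e h1 h2 h3 => ?_, fun e h1 f g h2 h3 h4 h5 => ?_, fun e h1 h2 f g h3 h4 h5 => ?_⟩
  · have i1 := mul_nonneg ha ((hu x).1 e h1 h2 h3)
    have i2 := mul_nonneg hb ((hv x).1 e h1 h2 h3)
    simp only [formS, hext] at *
    linarith
  · have i1 := mul_nonneg ha ((hu x).2.1 e h1 f g h2 h3 h4 h5)
    have i2 := mul_nonneg hb ((hv x).2.1 e h1 f g h2 h3 h4 h5)
    simp only [formT, hext] at *
    linarith
  · have i1 := mul_nonneg ha ((hu x).2.2 e h1 h2 f g h3 h4 h5)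
    have i2 := mul_nonneg hb ((hv x).2.2 e h1 h2 f g h3 h4 h5)
    simp only [formP, hext] at *
    linarith

end Forms

/-! ### Integer points of triangles -/

/-- A triangle of area at least one contains an integer point which is not a vertex. -/
theorem exists_point_of_two_le_cross {b c : ℤ × ℤ} (h : 2 ≤ cross b c) :
    ∃ (y : ℤ × ℤ) (i j : ℤ), 0 ≤ i ∧ 0 ≤ j ∧ i + j ≤ cross b c ∧ i < cross b c ∧ j < cross b c ∧
      (0 < i ∨ 0 < j) ∧ cross b c * y.1 = i * b.1 + j * c.1 ∧
      cross b c * y.2 = i * b.2 + j * c.2 := by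
  set n := cross b c with hn
  have hn0 : 0 < n := by omega
  -- The lattice spanned by `b, c` has index `n ≥ 2`. If it were all of `ℤ²`, then `n²` would divide
  -- the determinant `n`.
  obtain ⟨z, hz⟩ : ∃ z : ℤ × ℤ, ¬ (n ∣ cross z c ∧ n ∣ cross b z) := by
    by_contra! hc
    obtain ⟨⟨p, hp⟩, ⟨q, hq⟩⟩ := hc (1, 0)
    obtain ⟨⟨r, hr⟩, ⟨s, hs⟩⟩ := hc (0, 1)
    simp only [cross, one_mul, zero_mul, mul_zero, mul_one, sub_zero, zero_sub] at hp hq hr hs hn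
    have : n * 1 = n * (n * (s * p - q * r)) := by
      have e1 : c.1 = -(n * r) := by omega
      have e2 : b.2 = -(n * q) := by omega
      rw [hp, hs, e1, e2] at hn
      linear_combination hn
    have h1 : n ∣ 1 := ⟨_, mul_left_cancel₀ hn0.ne' this⟩
    have := Int.le_of_dvd one_pos h1
    omega
  set i := cross z c
  set j := cross b z
  have h1 : n * z.1 = i * b.1 + j * c.1 := by simp only [n, i, j, cross]; ring
  have h2 : n * z.2 = i * b.2 + j * c.2 := by simp only [n, i, j, cross]; ring
  have hi := Int.mul_ediv_add_emod i n
  have hj := Int.mul_ediv_add_emod j n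
  have hi0 := Int.emod_nonneg i hn0.ne'
  have hj0 := Int.emod_nonneg j hn0.ne'
  have hin := Int.emod_lt_of_pos i hn0
  have hjn := Int.emod_lt_of_pos j hn0
  have hij : 0 < i % n ∨ 0 < j % n := by
    by_contra! hc
    exact hz ⟨Int.dvd_of_emod_eq_zero (by omega), Int.dvd_of_emod_eq_zero (by omega)⟩
  set I := i % n
  set J := j % n
  set r := i / n
  set s := j / n
  -- After reduction modulo `b, c` the point is in the fundamental parallelogram; the symmetry `y ↦
  -- b + c - y` brings its far half back to the triangle.
  by_cases hs : I + J ≤ n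
  · refine ⟨z - r • b - s • c, I, J, hi0, hj0, hs, hin, hjn, hij, ?_, ?_⟩
    · simp only [Prod.fst_sub, Prod.smul_fst, smul_eq_mul]
      linear_combination h1 - b.1 * hi - c.1 * hj
    · simp only [Prod.snd_sub, Prod.smul_snd, smul_eq_mul]
      linear_combination h2 - b.2 * hi - c.2 * hj
  · refine ⟨b + c - (z - r • b - s • c), n - I, n - J, by omega, by omega, by omega, by omega,
      by omega, by omega, ?_, ?_⟩
    · simp only [Prod.fst_sub, Prod.fst_add, Prod.smul_fst, smul_eq_mul]
      linear_combination -h1 + b.1 * hi + c.1 * hj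
    · simp only [Prod.snd_sub, Prod.snd_add, Prod.smul_snd, smul_eq_mul]
      linear_combination -h2 + b.2 * hi + c.2 * hj

/-- The set contains a primitive segment or a triangle of area `3 / 2` centered at the origin. -/
def HasCentered (C : Set (ℝ × ℝ)) : Prop :=
  (∃ e, IsIrred e ∧ toPlane e ∈ C ∧ toPlane (-e) ∈ C) ∨
  ∃ a b c : ℤ × ℤ, toPlane a ∈ C ∧ toPlane b ∈ C ∧ toPlane c ∈ C ∧
    cross a b = 1 ∧ cross b c = 1 ∧ cross c a = 1

/-- Both ends are nonzero multiples, of opposite signs, of one primitive vector, so this vector and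
its opposite are on the segment. -/
theorem hasCentered_of_segment {C : Set (ℝ × ℝ)} (hC : Convex ℝ C) {a b : ℤ × ℤ}
    (ha : toPlane a ∈ C) (hb : toPlane b ∈ C) (h : cross a b = 0) (hd : dot a b < 0) :
    HasCentered C := by
  left
  have hg0 : 0 < Int.gcd a.1 a.2 := by
    refine Nat.pos_of_ne_zero fun h0 => ?_
    obtain ⟨h1, h2⟩ := Int.gcd_eq_zero_iff.1 h0
    simp [dot, h1, h2] at hd
  obtain ⟨m, n, hmn, h1, h2⟩ := Int.exists_gcd_one hg0
  set g : ℤ := (Int.gcd a.1 a.2 : ℤ)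
  have hg : 1 ≤ g := Int.natCast_pos.2 hg0
  have hirr : IsIrred (m, n) := hmn
  obtain ⟨s, t, hst⟩ := isIrred_iff.1 hirr
  simp only at hst
  set k := s * b.1 + t * b.2 with hk
  have h0 : m * b.2 - n * b.1 = 0 := by
    have : g * (m * b.2 - n * b.1) = 0 := by
      rw [cross, h1, h2] at h; linear_combination h
    exact (mul_eq_zero.1 this).resolve_left (by omega)
  have hb1 : b.1 = k * m := by rw [hk]; linear_combination (-b.1) * hst - t * h0
  have hb2 : b.2 = k * n := by rw [hk]; linear_combination (-b.2) * hst + s * h0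
  have hk0 : k < 0 := by
    by_contra! hc
    have : dot a b = g * k * dot (m, n) (m, n) := by
      rw [dot, h1, h2, hb1, hb2, dot]; ring
    have h3 := dot_self_nonneg (m, n)
    have : 0 ≤ g * k * dot (m, n) (m, n) := by positivity
    omega
  refine ⟨(m, n), hirr, ?_, ?_⟩
  · refine toPlane_mem_of_convex hC ha hb hb (i := 1 - k) (j := g - 1) (k := 0) (n := g - k)
      (by omega) (by omega) le_rfl (by omega) (by ring) ?_ ?_
    · rw [h1, hb1]; ring
    · rw [h2, hb2]; ring
  · refine toPlane_mem_of_convex hC ha hb hb (i := -1 - k) (j := g + 1) (k := 0) (n := g - k)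
      (by omega) (by omega) le_rfl (by omega) (by ring) ?_ ?_
    · rw [h1, hb1]; simp only [Prod.fst_neg]; ring
    · rw [h2, hb2]; simp only [Prod.snd_neg]; ring

/-- An additional integer point `y` of the triangle `0, b, c` replaces `c` or `b`, according to its
side of the line through `0` and `a`: the origin stays inside and the area drops. If `y` is on this
line, the origin is between `a` and `y`. -/
theorem hasCentered_step {C : Set (ℝ × ℝ)} (hC : Convex ℝ C) {a b c : ℤ × ℤ}
    (ha : toPlane a ∈ C) (hb : toPlane b ∈ C) (hc : toPlane c ∈ C)
    (h1 : 2 ≤ cross b c) (h2 : 0 < cross c a) (h3 : 0 < cross a b)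
    (ih : ∀ a' b' c' : ℤ × ℤ, toPlane a' ∈ C → toPlane b' ∈ C → toPlane c' ∈ C →
      0 < cross b' c' → 0 < cross c' a' → 0 < cross a' b' →
      cross b' c' + cross c' a' + cross a' b' < cross b c + cross c a + cross a b →
        HasCentered C) : HasCentered C := by
  obtain ⟨y, i, j, hi, hj, hij, hin, hjn, hpos, hy1, hy2⟩ := exists_point_of_two_le_cross h1
  set D1 := cross b c with hD1
  set D2 := cross c a with hD2
  set D3 := cross a b with hD3
  have h0 : toPlane 0 ∈ C := by
    refine toPlane_mem_of_convex hC ha hb hc (i := D1) (j := D2) (k := D3) (n := D1 + D2 + D3)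
      (by omega) h2.le h3.le (by omega) (by ring) ?_ ?_
    · simp only [D1, D2, D3, cross, Prod.fst_zero]; ring
    · simp only [D1, D2, D3, cross, Prod.snd_zero]; ring
  have hyC : toPlane y ∈ C := by
    refine toPlane_mem_of_convex hC h0 hb hc (i := D1 - i - j) (j := i) (k := j) (n := D1)
      (by omega) hi hj (by omega) (by ring) ?_ ?_
    · simp only [Prod.fst_zero]; linarith
    · simp only [Prod.snd_zero]; linarith
  have eyc : cross y c = i := by
    have : D1 * cross y c = D1 * i := by
      simp only [cross] at hD1 ⊢; linear_combination c.2 * hy1 - c.1 * hy2 - i * hD1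
    exact mul_left_cancel₀ (by omega) this
  have eby : cross b y = j := by
    have : D1 * cross b y = D1 * j := by
      simp only [cross] at hD1 ⊢; linear_combination b.1 * hy2 - b.2 * hy1 - j * hD1
    exact mul_left_cancel₀ (by omega) this
  have eay : D1 * cross a y = i * D3 - j * D2 := by
    simp only [D3, D2, cross]; linear_combination a.1 * hy2 - a.2 * hy1
  have eya : cross y a = - cross a y := by simp only [cross]; ring
  rcases lt_trichotomy (cross a y) 0 with h | h | h
  · refine ih a b y ha hb hyC ?_ (by omega) h3 ?_
    · rw [eby]
      by_contra hc
      have : 0 ≤ i * D3 := by positivity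
      have hj0 : j = 0 := by omega
      rw [hj0] at eay
      nlinarith
    · rw [eby, eya]
      have : D1 * (j - cross a y + D3) < D1 * (D1 + D2 + D3) := by
        have e1 : D1 * (j - cross a y + D3) = D1 * j - i * D3 + j * D2 + D1 * D3 := by
          linear_combination -eay
        have e2 : j * (D1 + D2) < D1 * (D1 + D2) :=
          mul_lt_mul_of_pos_right hjn (by omega)
        have e3 : 0 ≤ i * D3 := by positivity
        rw [e1]; linarith
      have := lt_of_mul_lt_mul_left this (by omega)
      omega
  · refine hasCentered_of_segment hC ha hyC h ?_
    have hij' : i * D3 = j * D2 := by rw [h] at eay; linarith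
    have hi0 : 0 < i := by
      by_contra hc
      have hi0 : i = 0 := by omega
      rw [hi0] at hij'
      have : j = 0 := by
        have : j * D2 = 0 := by linarith
        exact (mul_eq_zero.1 this).resolve_right h2.ne'
      omega
    have e1 : D2 * y.1 = -(i * a.1) := by
      have : D1 * (D2 * y.1) = D1 * -(i * a.1) := by
        have : D1 * a.1 = -(D2 * b.1 + D3 * c.1) := by simp only [D1, D2, D3, cross]; ring
        linear_combination D2 * hy1 + i * this - c.1 * hij'
      exact mul_left_cancel₀ (by omega) this
    have e2 : D2 * y.2 = -(i * a.2) := by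
      have : D1 * (D2 * y.2) = D1 * -(i * a.2) := by
        have : D1 * a.2 = -(D2 * b.2 + D3 * c.2) := by simp only [D1, D2, D3, cross]; ring
        linear_combination D2 * hy2 + i * this - c.2 * hij'
      exact mul_left_cancel₀ (by omega) this
    have ha0 : a ≠ 0 := by rintro rfl; simp [cross] at hD3; omega
    have e3 : D2 * dot a y = -(i * dot a a) := by
      simp only [dot]; linear_combination a.1 * e1 + a.2 * e2
    have := mul_pos hi0 (dot_self_pos ha0)
    by_contra! hcon
    have := mul_nonneg h2.le hcon
    omega
  · refine ih a y c ha hyC hc ?_ h2 h ?_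
    · rw [eyc]
      by_contra hc
      have : 0 ≤ j * D2 := by positivity
      have hi0 : i = 0 := by omega
      rw [hi0] at eay
      nlinarith
    · rw [eyc]
      have : D1 * (i + D2 + cross a y) < D1 * (D1 + D2 + D3) := by
        have e1 : D1 * (i + D2 + cross a y) = D1 * i + D1 * D2 + i * D3 - j * D2 := by
          linear_combination eay
        have e2 : i * (D1 + D3) < D1 * (D1 + D3) :=
          mul_lt_mul_of_pos_right hin (by omega)
        have e3 : 0 ≤ j * D2 := by positivity
        rw [e1]; linarith
      have := lt_of_mul_lt_mul_left this (by omega)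
      omega

/-- Descent on the doubled area, which stops when the origin cuts the triangle into three unimodular
ones. -/
theorem hasCentered_of_triangle {C : Set (ℝ × ℝ)} (hC : Convex ℝ C) (N : ℕ) {a b c : ℤ × ℤ}
    (ha : toPlane a ∈ C) (hb : toPlane b ∈ C) (hc : toPlane c ∈ C)
    (h1 : 0 < cross b c) (h2 : 0 < cross c a) (h3 : 0 < cross a b)
    (hN : cross b c + cross c a + cross a b ≤ N) : HasCentered C := by
  induction N generalizing a b c with
  | zero => push_cast at hN; omega
  | succ N ih =>
    push_cast at hN
    by_cases e1 : 2 ≤ cross b c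
    · exact hasCentered_step hC ha hb hc e1 h2 h3 fun a' b' c' ha hb hc g1 g2 g3 g =>
        ih ha hb hc g1 g2 g3 (by omega)
    by_cases e2 : 2 ≤ cross c a
    · exact hasCentered_step hC hb hc ha e2 h3 h1 fun a' b' c' ha hb hc g1 g2 g3 g =>
        ih ha hb hc g1 g2 g3 (by omega)
    by_cases e3 : 2 ≤ cross a b
    · exact hasCentered_step hC hc ha hb e3 h1 h2 fun a' b' c' ha hb hc g1 g2 g3 g =>
        ih ha hb hc g1 g2 g3 (by omega)
    exact Or.inr ⟨a, b, c, ha, hb, hc, by omega, by omega, by omega⟩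

theorem hasCentered_of_pair {C : Set (ℝ × ℝ)} (hC : Convex ℝ C) {a b : ℤ × ℤ}
    (ha : toPlane a ∈ C) (hb : toPlane b ∈ C) (hb0 : b ≠ 0) {s t : ℝ} (hs : 0 ≤ s)
    (ht : 0 ≤ t) (hst : s + t = 1) (h : s • toPlane a + t • toPlane b = 0) (ha0 : a ≠ 0) :
    HasCentered C := by
  have h1 : s * a.1 + t * b.1 = 0 := by simpa [toPlane] using congrArg Prod.fst h
  have h2 : s * a.2 + t * b.2 = 0 := by simpa [toPlane] using congrArg Prod.snd h
  have haa : (0 : ℝ) < a.1 * a.1 + a.2 * a.2 := by exact_mod_cast dot_self_pos ha0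
  have hbb : (0 : ℝ) < b.1 * b.1 + b.2 * b.2 := by exact_mod_cast dot_self_pos hb0
  have hs0 : 0 < s := by
    refine hs.lt_of_ne fun h0 => ?_
    rw [← h0] at h1 h2 hst
    have ht1 : t = 1 := by linarith
    have e1 : (b.1 : ℝ) = 0 := by rw [ht1] at h1; linarith
    have e2 : (b.2 : ℝ) = 0 := by rw [ht1] at h2; linarith
    simp [e1, e2] at hbb
  have ht0 : 0 < t := by
    refine ht.lt_of_ne fun h0 => ?_
    rw [← h0] at h1 h2 hst
    have hs1 : s = 1 := by linarith
    have e1 : (a.1 : ℝ) = 0 := by rw [hs1] at h1; linarith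
    have e2 : (a.2 : ℝ) = 0 := by rw [hs1] at h2; linarith
    simp [e1, e2] at haa
  refine hasCentered_of_segment hC ha hb ?_ ?_
  · have : t * (a.1 * b.2 - a.2 * b.1) = 0 := by linear_combination a.1 * h2 - a.2 * h1
    have := (mul_eq_zero.1 this).resolve_left ht0.ne'
    simp only [cross]
    exact_mod_cast this
  · have h3 : t * (a.1 * b.1 + a.2 * b.2) = -(s * (a.1 * a.1 + a.2 * a.2)) := by
      linear_combination a.1 * h1 + a.2 * h2
    have h4 : (a.1 * b.1 + a.2 * b.2 : ℝ) < 0 := by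
      by_contra! hc
      have := mul_nonneg ht hc
      have := mul_pos hs0 haa
      linarith
    simp only [dot]
    exact_mod_cast h4

/-- A convex set which contains the origin as a nontrivial combination of three integer points. -/
theorem hasCentered_of_weights {C : Set (ℝ × ℝ)} (hC : Convex ℝ C) {a b c : ℤ × ℤ}
    (ha : toPlane a ∈ C) (hb : toPlane b ∈ C) (hc : toPlane c ∈ C) (ha0 : a ≠ 0) (hb0 : b ≠ 0)
    (hc0 : c ≠ 0) {r s t : ℝ} (hr : 0 ≤ r) (hs : 0 ≤ s) (ht : 0 ≤ t) (hrst : r + s + t = 1)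
    (h : r • toPlane a + s • toPlane b + t • toPlane c = 0) : HasCentered C := by
  rcases hr.eq_or_lt with rfl | hr
  · exact hasCentered_of_pair hC hb hc hc0 hs ht (by linarith) (by simpa using h) hb0
  rcases hs.eq_or_lt with rfl | hs
  · exact hasCentered_of_pair hC ha hc hc0 hr.le ht (by linarith) (by simpa using h) ha0
  rcases ht.eq_or_lt with rfl | ht
  · exact hasCentered_of_pair hC ha hb hb0 hr.le hs.le (by linarith) (by simpa using h) ha0
  have h1 : r * a.1 + s * b.1 + t * c.1 = 0 := by simpa [toPlane] using congrArg Prod.fst h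
  have h2 : r * a.2 + s * b.2 + t * c.2 = 0 := by simpa [toPlane] using congrArg Prod.snd h
  -- The weights are proportional to the three determinants, which therefore share a sign: it gives
  -- the orientation, or shows that all points are on a line through the origin.
  have e12 : r * (cross c a : ℤ) = s * (cross b c : ℤ) := by
    simp only [cross]; push_cast; linear_combination c.1 * h2 - c.2 * h1
  have e13 : r * (cross a b : ℤ) = t * (cross b c : ℤ) := by
    simp only [cross]; push_cast; linear_combination b.2 * h1 - b.1 * h2
  have ecb : cross c b = - cross b c := by simp only [cross]; ring
  have eba : cross b a = - cross a b := by simp only [cross]; ring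
  have eac : cross a c = - cross c a := by simp only [cross]; ring
  rcases lt_trichotomy (cross b c) 0 with hD | hD | hD
  · have hD' : ((cross b c : ℤ) : ℝ) < 0 := by exact_mod_cast hD
    have i1 : ((cross c a : ℤ) : ℝ) < 0 := by
      by_contra! hcon
      have := mul_nonneg hr.le hcon
      have := mul_neg_of_pos_of_neg hs hD'
      linarith
    have i2 : ((cross a b : ℤ) : ℝ) < 0 := by
      by_contra! hcon
      have := mul_nonneg hr.le hcon
      have := mul_neg_of_pos_of_neg ht hD'
      linarith
    have i1' : cross c a < 0 := by exact_mod_cast i1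
    have i2' : cross a b < 0 := by exact_mod_cast i2
    exact hasCentered_of_triangle hC _ ha hc hb (by omega) (by omega) (by omega)
      (Int.self_le_toNat _)
  · have hD' : ((cross b c : ℤ) : ℝ) = 0 := by exact_mod_cast hD
    rw [hD', mul_zero] at e12 e13
    have i1 : cross c a = 0 := by exact_mod_cast (mul_eq_zero.1 e12).resolve_left hr.ne'
    have i2 : cross a b = 0 := by exact_mod_cast (mul_eq_zero.1 e13).resolve_left hr.ne'
    have haa : (0 : ℝ) < (dot a a : ℤ) := by exact_mod_cast dot_self_pos ha0
    have hd : r * (dot a a : ℤ) + s * (dot a b : ℤ) + t * (dot a c : ℤ) = 0 := by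
      simp only [dot]; push_cast; linear_combination a.1 * h1 + a.2 * h2
    by_cases j1 : dot a b < 0
    · exact hasCentered_of_segment hC ha hb i2 j1
    by_cases j2 : dot a c < 0
    · exact hasCentered_of_segment hC ha hc (by omega) j2
    push Not at j1 j2
    have j1' : (0 : ℝ) ≤ (dot a b : ℤ) := by exact_mod_cast j1
    have j2' : (0 : ℝ) ≤ (dot a c : ℤ) := by exact_mod_cast j2
    have k1 := mul_nonneg hs.le j1'
    have k2 := mul_nonneg ht.le j2'
    have k3 := mul_pos hr haa
    linarith
  · have hD' : (0 : ℝ) < (cross b c : ℤ) := by exact_mod_cast hD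
    have i1 : (0 : ℝ) < (cross c a : ℤ) := by
      by_contra! hcon
      have := mul_nonpos_of_nonneg_of_nonpos hr.le hcon
      have := mul_pos hs hD'
      linarith
    have i2 : (0 : ℝ) < (cross a b : ℤ) := by
      by_contra! hcon
      have := mul_nonpos_of_nonneg_of_nonpos hr.le hcon
      have := mul_pos ht hD'
      linarith
    exact hasCentered_of_triangle hC _ ha hb hc hD (by exact_mod_cast i1) (by exact_mod_cast i2)
      (Int.self_le_toNat _)

/-- One of the pairs of an oriented superbase is obtuse. -/
theorem exists_isParents_of_superbase {a b c : ℤ × ℤ} (h1 : cross a b = 1) (h2 : cross b c = 1)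
    (h3 : cross c a = 1) :
    IsParents (-a) (-b) c ∨ IsParents (-b) (-c) a ∨ IsParents (-c) (-a) b := by
  have hsum : c = -a + -b := by
    simp only [cross] at *
    ext
    · simp only [Prod.fst_add, Prod.fst_neg]
      linear_combination (-a.1) * h2 - b.1 * h3 - c.1 * h1
    · simp only [Prod.snd_add, Prod.snd_neg]
      linear_combination (-a.2) * h2 - b.2 * h3 - c.2 * h1
  have key : ∀ {x y z : ℤ × ℤ}, cross x y = 1 → z = -x + -y → 0 ≤ dot x y →
      IsParents (-x) (-y) z := by
    intro x y z g1 g2 g3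
    refine ⟨?_, ?_, g2⟩
    · simp only [cross, Prod.fst_neg, Prod.snd_neg] at *; linarith
    · simp only [dot, Prod.fst_neg, Prod.snd_neg] at *; linarith
  by_cases d1 : 0 ≤ dot a b
  · exact Or.inl (key h1 hsum d1)
  by_cases d2 : 0 ≤ dot b c
  · exact Or.inr (Or.inl (key h2 (by rw [hsum]; abel) d2))
  by_cases d3 : 0 ≤ dot c a
  · exact Or.inr (Or.inr (key h3 (by rw [hsum]; abel) d3))
  have e1 : dot b c = -dot b b - dot a b := by
    rw [hsum]; simp only [dot, Prod.fst_add, Prod.snd_add, Prod.fst_neg, Prod.snd_neg]; ring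
  have e2 : dot c a = -dot a a - dot a b := by
    rw [hsum]; simp only [dot, Prod.fst_add, Prod.snd_add, Prod.fst_neg, Prod.snd_neg]; ring
  have e3 : dot a a * dot b b = cross a b * cross a b + dot a b * dot a b := by
    simp only [dot, cross]; ring
  rw [h1] at e3
  -- If all three scalar products were negative, `m = -dot a b ≥ 1` would be smaller than both
  -- squared norms, against `(m + 1)² > 1 + m²`.
  have : (-dot a b + 1) * (-dot a b + 1) ≤ dot a a * dot b b :=
    mul_le_mul (by omega) (by omega) (by omega) (by omega)
  nlinarith

/-- Repetitions are allowed, so that points, segments and triangles are handled together. -/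
theorem exists_eq_triple {t : Finset (ℝ × ℝ)} (ht : AffineIndependent ℝ ((↑) : t → ℝ × ℝ))
    (hne : t.Nonempty) : ∃ p q r, (t : Set (ℝ × ℝ)) = {p, q, r} := by
  have hcard : t.card ≤ 3 := by
    have h1 := ht.card_le_finrank_succ
    have h2 : Module.finrank ℝ (vectorSpan ℝ (Set.range ((↑) : t → ℝ × ℝ))) ≤ 2 := by
      refine (Submodule.finrank_le _).trans ?_
      simp
    simp only [Fintype.card_coe] at h1
    omega
  have hpos := hne.card_pos
  obtain h | h | h : t.card = 1 ∨ t.card = 2 ∨ t.card = 3 := by omega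
  · obtain ⟨p, rfl⟩ := Finset.card_eq_one.1 h
    exact ⟨p, p, p, by simp⟩
  · obtain ⟨p, q, -, rfl⟩ := Finset.card_eq_two.1 h
    exact ⟨p, q, q, by simp⟩
  · obtain ⟨p, q, r, -, -, -, rfl⟩ := Finset.card_eq_three.1 h
    exact ⟨p, q, r, by simp⟩

theorem mem_convexHull_triple {p q r y : ℝ × ℝ} (h : y ∈ convexHull ℝ {p, q, r}) :
    ∃ a b c : ℝ, 0 ≤ a ∧ 0 ≤ b ∧ 0 ≤ c ∧ a + b + c = 1 ∧ a • p + b • q + c • r = y := by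
  rw [convexHull_insert (by simp), convexHull_pair, mem_convexJoin] at h
  obtain ⟨p', hp', z, ⟨b, c, hb, hc, hbc, rfl⟩, ⟨s, t, hs, ht, hst, rfl⟩⟩ := h
  rw [Set.mem_singleton_iff.1 hp']
  exact ⟨s, t * b, t * c, hs, mul_nonneg ht hb, mul_nonneg ht hc,
    by rw [add_assoc, ← mul_add, hbc, mul_one, hst], by module⟩

/-! ### Affine minorants and the maximum principle -/

/-- The affine function on the plane with the given coefficients. -/
def aff (θ : ℝ × ℝ × ℝ) (p : ℝ × ℝ) : ℝ := θ.1 * p.1 + θ.2.1 * p.2 + θ.2.2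

theorem aff_combo (θ : ℝ × ℝ × ℝ) (p q : ℝ × ℝ) {s t : ℝ} (h : s + t = 1) :
    aff θ (s • p + t • q) = s * aff θ p + t * aff θ q := by
  simp only [aff, Prod.fst_add, Prod.snd_add, Prod.smul_fst, Prod.smul_snd, smul_eq_mul]
  linear_combination (-θ.2.2) * h

theorem toPlane_add (a b : ℤ × ℤ) : toPlane (a + b) = toPlane a + toPlane b := by
  simp [toPlane]

theorem toPlane_sub (a b : ℤ × ℤ) : toPlane (a - b) = toPlane a - toPlane b := by
  simp [toPlane]

/-- The affine function is a minorant of `u` on `X`. -/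
def IsMinorant {X : Set (ℤ × ℤ)} (u : X → ℝ) (θ : ℝ × ℝ × ℝ) : Prop :=
  ∀ x : X, aff θ (toPlane x) ≤ u x

/-- The points of `X` at which a function agrees with an affine function. -/
def contact {X : Set (ℤ × ℤ)} (u : X → ℝ) (θ : ℝ × ℝ × ℝ) : Set (ℝ × ℝ) :=
  {p | ∃ x : X, toPlane x = p ∧ aff θ (toPlane x) = u x}

theorem contact_subset {X : Set (ℤ × ℤ)} (u : X → ℝ) (θ : ℝ × ℝ × ℝ) :
    contact u θ ⊆ toPlane '' X := by
  rintro _ ⟨x, rfl, -⟩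
  exact ⟨x, x.2, rfl⟩

/-- The segment forms and the triangle forms with support in `X` are positive. -/
def PositiveForms (X : Set (ℤ × ℤ)) (v : ℤ × ℤ → ℝ) : Prop :=
  (∀ x e, IsIrred e → x ∈ X → x + e ∈ X → x - e ∈ X → 0 < formS x e v) ∧
  ∀ x e f g, IsParents f g e → x ∈ X → x + e ∈ X → x - f ∈ X → x - g ∈ X → 0 < formT x e f g v

/-- The integer points of the convex hull of a contact set belong to this contact set. -/
theorem mem_contact_of_mem_convexHull {X : Set (ℤ × ℤ)} (hX : LatticeConvex X) (hXf : X.Finite)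
    {u : X → ℝ} (hu : PositiveForms X (extend u)) {θ : ℝ × ℝ × ℝ} (hθ : IsMinorant u θ)
    {z : ℤ × ℤ} (hz : toPlane z ∈ convexHull ℝ (contact u θ)) : toPlane z ∈ contact u θ := by
  set C := convexHull ℝ (contact u θ) with hC
  have hCc : Convex ℝ C := convex_convexHull ℝ _
  have hCX : ∀ y, toPlane y ∈ C → y ∈ X := fun y hy =>
    hX y (convexHull_mono (contact_subset u θ) hy)
  set w : ℤ × ℤ → ℝ := fun y => extend u y - aff θ (toPlane y) with hw
  have hw0 : ∀ y ∈ X, 0 ≤ w y := fun y hy => by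
    have := hθ ⟨y, hy⟩
    simp only [hw, extend_of_mem u hy]
    linarith
  -- Maximum principle for the excess `w`. The forms vanish on affine functions, hence take the same
  -- value on `w` and on `u`; around a maximum over `C` this value is at most `0`.
  obtain ⟨y, hyC, hmax⟩ := (hXf.subset (fun y hy => hCX y hy : {y | toPlane y ∈ C} ⊆ X)).exists_maximalFor
    w _ ⟨z, hz⟩
  replace hmax : ∀ y', toPlane y' ∈ C → w y' ≤ w y := fun y' hy' => by
    rcases le_total (w y') (w y) with h | h
    · exact h
    · exact hmax hy' h
  have hmem : ∀ y', toPlane y' ∈ C → w y' = 0 → toPlane y' ∈ contact u θ := fun y' hy' h =>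
    ⟨⟨y', hCX y' hy'⟩, rfl, by
      simp only [hw, extend_of_mem u (hCX y' hy')] at h
      linarith⟩
  refine hmem z hz (le_antisymm ((hmax z hz).trans ?_) (hw0 z (hCX z hz)))
  by_contra! hpos
  have hyn : toPlane y ∉ contact u θ := by
    rintro ⟨x, hx, h⟩
    have hxy : (x : ℤ × ℤ) = y := toPlane_injective hx
    have : w y = 0 := by simp only [hw, ← hxy, extend_apply, h, sub_self]
    exact hpos.ne' this
  have hyC' : toPlane y ∈ convexHull ℝ (contact u θ) := hyC
  -- By Carathéodory, at most three contact points surround `y`, all different from `y` because `w`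
  -- vanishes at them.
  rw [convexHull_eq_union] at hyC'
  simp only [Set.mem_iUnion] at hyC'
  obtain ⟨t, ht, hind, hyt⟩ := hyC'
  have htne : t.Nonempty := by
    rw [Finset.nonempty_iff_ne_empty]
    rintro rfl
    simp at hyt
  obtain ⟨p, q, r, htr⟩ := exists_eq_triple hind htne
  rw [htr] at hyt ht
  obtain ⟨α, β, γ, h1, h2, h3, h4, h5⟩ := mem_convexHull_triple hyt
  have hoff : ∀ {p' : ℝ × ℝ}, p' ∈ ({p, q, r} : Set (ℝ × ℝ)) →
      ∃ a : ℤ × ℤ, a ≠ 0 ∧ toPlane y + toPlane a = p' ∧ toPlane y + toPlane a ∈ C := by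
    intro p' hp'
    obtain ⟨a, -, rfl⟩ := contact_subset u θ (ht hp')
    have e1 : toPlane y + toPlane (a - y) = toPlane a := by rw [toPlane_sub]; abel
    refine ⟨a - y, ?_, e1, ?_⟩
    · intro h
      rw [sub_eq_zero.1 h] at hp'
      exact hyn (ht hp')
    · rw [e1]; exact subset_convexHull ℝ _ (ht hp')
  obtain ⟨a, ha0, rfl, haC⟩ := hoff (p' := p) (by simp)
  obtain ⟨b, hb0, rfl, hbC⟩ := hoff (p' := q) (by simp)
  obtain ⟨c, hc0, rfl, hcC⟩ := hoff (p' := r) (by simp)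
  have hsum : α • toPlane a + β • toPlane b + γ • toPlane c = 0 := by
    have : α • toPlane a + β • toPlane b + γ • toPlane c
        = (α • (toPlane y + toPlane a) + β • (toPlane y + toPlane b)
          + γ • (toPlane y + toPlane c)) - (α + β + γ) • toPlane y := by module
    rw [this, h5, h4, one_smul, sub_self]
  have hmaxC : ∀ e, toPlane e ∈ (fun v => toPlane y + v) ⁻¹' C → y + e ∈ X ∧ w (y + e) ≤ w y := by
    intro e he
    have : toPlane (y + e) ∈ C := by rw [toPlane_add]; exact he
    exact ⟨hCX _ this, hmax _ this⟩
  have hyX := hCX y hyC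
  rcases hasCentered_of_weights (hCc.translate_preimage_right (toPlane y)) haC hbC hcC ha0 hb0 hc0
    h1 h2 h3 h4 hsum with ⟨e, he, he1, he2⟩ | ⟨a, b, c, ha, hb, hc, hab, hbc, hca⟩
  · obtain ⟨i1, i2⟩ := hmaxC e he1
    obtain ⟨i3, i4⟩ := hmaxC (-e) he2
    rw [← sub_eq_add_neg] at i3 i4
    have i5 := hu.1 y e he hyX i1 i3
    simp only [formS, hw, aff, toPlane, Prod.fst_add, Prod.snd_add, Prod.fst_sub, Prod.snd_sub]
      at i2 i4 i5
    push_cast at i2 i4 i5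
    linarith
  · have key : ∀ a b c : ℤ × ℤ, IsParents (-a) (-b) c →
        toPlane a ∈ (fun v => toPlane y + v) ⁻¹' C → toPlane b ∈ (fun v => toPlane y + v) ⁻¹' C →
        toPlane c ∈ (fun v => toPlane y + v) ⁻¹' C → False := by
      intro a b c hp ha hb hc
      obtain ⟨i1, i2⟩ := hmaxC a ha
      obtain ⟨j1, j2⟩ := hmaxC b hb
      obtain ⟨k1, k2⟩ := hmaxC c hc
      have i5 := hu.2 y c _ _ hp hyX k1 (by rwa [sub_neg_eq_add]) (by rwa [sub_neg_eq_add])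
      have hcab := hp.eq_add
      rw [hcab] at k2 i5
      simp only [formT, sub_neg_eq_add, hw, aff, toPlane, Prod.fst_add, Prod.snd_add, Prod.fst_neg,
        Prod.snd_neg] at i2 j2 k2 i5
      push_cast at i2 j2 k2 i5
      linarith
    rcases exists_isParents_of_superbase hab hbc hca with h | h | h
    · exact key _ _ _ h ha hb hc
    · exact key _ _ _ h hb hc ha
    · exact key _ _ _ h hc ha hb

/-! ### The triangulation associated to a generic function -/

section Lower

variable {X : Set (ℤ × ℤ)}

theorem finite_contact (hXf : X.Finite) (u : X → ℝ) (θ : ℝ × ℝ × ℝ) : (contact u θ).Finite :=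
  (hXf.image _).subset (contact_subset u θ)

theorem aff_add_smul (θ η : ℝ × ℝ × ℝ) (t : ℝ) (p : ℝ × ℝ) :
    aff (θ + t • η) p = aff θ p + t * aff η p := by
  simp only [aff, Prod.fst_add, Prod.snd_add, Prod.smul_fst, Prod.smul_snd, smul_eq_mul]
  ring

theorem aff_le_of_mem_convexHull {θ : ℝ × ℝ × ℝ} {s : Set (ℝ × ℝ)} {M : ℝ}
    (h : ∀ q ∈ s, aff θ q ≤ M) {p : ℝ × ℝ} (hp : p ∈ convexHull ℝ s) : aff θ p ≤ M := by
  have hconv : Convex ℝ {q | aff θ q ≤ M} := by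
    intro x hx y hy a b ha hb hab
    simp only [Set.mem_ofPred_eq] at *
    rw [aff_combo θ x y hab]
    calc a * aff θ x + b * aff θ y ≤ a * M + b * M := by gcongr
      _ = M := by rw [← add_mul, hab, one_mul]
  exact convexHull_min h hconv hp

/-- Over an interior point of the hull, there is a minorant whose contact set surrounds this
point. -/
theorem exists_isMinorant (hXf : X.Finite) (u : X → ℝ) {p : ℝ × ℝ} (hp : p ∈ interior (hull X)) :
    ∃ θ, IsMinorant u θ ∧ p ∈ convexHull ℝ (contact u θ) := by
  have : Finite X := hXf
  obtain ⟨m, hm⟩ := (Set.finite_range u).bddBelow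
  obtain ⟨M, hM⟩ := (Set.finite_range u).bddAbove
  have hm' : ∀ x, m ≤ u x := fun x => hm ⟨x, rfl⟩
  have hM' : ∀ x, u x ≤ M := fun x => hM ⟨x, rfl⟩
  obtain ⟨r, hr, hball⟩ := Metric.isOpen_iff.1 isOpen_interior p hp
  -- The minorant sought has the largest value at `p`. Compactness uses that `p` is interior: an
  -- affine function at least `m` at `p` and at most `M` on a ball around it has bounded slopes.
  set K : Set (ℝ × ℝ × ℝ) := {θ | IsMinorant u θ ∧ m ≤ aff θ p} with hK
  have hcont : ∀ q, Continuous fun θ : ℝ × ℝ × ℝ => aff θ q := fun q => by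
    simp only [aff]; fun_prop
  have hKne : (0, 0, m) ∈ K := by
    refine ⟨fun x => ?_, ?_⟩
    · simpa [aff] using hm' x
    · simp [aff]
  have hKc : IsCompact K := by
    have hclosed : IsClosed K := by
      have : K = (⋂ x : X, {θ | aff θ (toPlane x) ≤ u x}) ∩ {θ | m ≤ aff θ p} := by
        ext θ; simp [hK, IsMinorant]
      rw [this]
      exact (isClosed_iInter fun x => isClosed_le (hcont _) continuous_const).inter
        (isClosed_le continuous_const (hcont _))
    set B := (M - m) / (r / 2) with hB
    refine (isCompact_Icc (a := ((-B, -B, m - B * |p.1| - B * |p.2|) : ℝ × ℝ × ℝ))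
      (b := (B, B, M + B * |p.1| + B * |p.2|))).of_isClosed_subset hclosed ?_
    rintro ⟨a, b, c⟩ ⟨h1, h2⟩
    have hle : ∀ q ∈ hull X, aff (a, b, c) q ≤ M := fun q hq => by
      refine aff_le_of_mem_convexHull ?_ hq
      rintro _ ⟨x, hx, rfl⟩
      exact (h1 ⟨x, hx⟩).trans (hM' _)
    have hnear : ∀ q : ℝ × ℝ, |q.1 - p.1| ≤ r / 2 → |q.2 - p.2| ≤ r / 2 →
        aff (a, b, c) q ≤ M := by
      intro q h3 h4
      refine hle q (interior_subset (hball ?_))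
      rw [Metric.mem_ball, Prod.dist_eq, Real.dist_eq, Real.dist_eq]
      exact max_lt (by linarith) (by linarith)
    have hr2 : |r / 2| ≤ r / 2 := by rw [abs_of_pos (by linarith)]
    have k1 := hnear (p.1 + r / 2, p.2) (by simpa using hr2) (by simp; linarith)
    have k2 := hnear (p.1 - r / 2, p.2) (by simpa using hr2) (by simp; linarith)
    have k3 := hnear (p.1, p.2 + r / 2) (by simp; linarith) (by simpa using hr2)
    have k4 := hnear (p.1, p.2 - r / 2) (by simp; linarith) (by simpa using hr2)
    have k5 := hnear p (by simp; linarith) (by simp; linarith)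
    simp only [aff] at h2 k1 k2 k3 k4 k5
    have hr0 : 0 < r / 2 := by linarith
    have a1 : a ≤ B := by rw [hB, le_div_iff₀ hr0]; linarith
    have a2 : -B ≤ a := by rw [neg_le, hB, le_div_iff₀ hr0]; linarith
    have b1 : b ≤ B := by rw [hB, le_div_iff₀ hr0]; linarith
    have b2 : -B ≤ b := by rw [neg_le, hB, le_div_iff₀ hr0]; linarith
    have a3 : |a * p.1| ≤ B * |p.1| := by
      rw [abs_mul]; exact mul_le_mul_of_nonneg_right (abs_le.2 ⟨a2, a1⟩) (abs_nonneg _)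
    have b3 : |b * p.2| ≤ B * |p.2| := by
      rw [abs_mul]; exact mul_le_mul_of_nonneg_right (abs_le.2 ⟨b2, b1⟩) (abs_nonneg _)
    rw [abs_le] at a3 b3
    refine ⟨⟨a2, b2, ?_⟩, ⟨a1, b1, ?_⟩⟩ <;> simp only <;> linarith
  obtain ⟨θ, ⟨hθ, hθm⟩, hmax⟩ := hKc.exists_isMaxOn ⟨_, hKne⟩ (hcont p).continuousOn
  refine ⟨θ, hθ, ?_⟩
  by_contra hnot
  -- The separating function `η = f - c` is negative on the contact set and positive at `p`. Adding
  -- a small multiple of it still gives a minorant, by the slack at the other points, and increases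
  -- the value at `p`.
  obtain ⟨f, c, hf1, hf2⟩ := geometric_hahn_banach_closed_point (convex_convexHull ℝ _)
    ((finite_contact hXf u θ).isClosed_convexHull ℝ) hnot
  set η : ℝ × ℝ × ℝ := (f (1, 0), f (0, 1), -c) with hη
  have haff : ∀ q, aff η q = f q - c := by
    intro q
    have : q = q.1 • ((1, 0) : ℝ × ℝ) + q.2 • ((0, 1) : ℝ × ℝ) := by ext <;> simp
    conv_rhs => rw [this]
    rw [map_add, map_smul, map_smul]
    simp only [aff, hη, smul_eq_mul]; ring
  have hev : ∀ x : X, ∀ᶠ t in nhdsWithin (0 : ℝ) (Set.Ioi 0),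
      aff (θ + t • η) (toPlane x) ≤ u x := by
    intro x
    by_cases hx : aff θ (toPlane x) = u x
    · filter_upwards [self_mem_nhdsWithin] with t ht
      have h1 := hf1 _ (subset_convexHull ℝ _ ⟨x, rfl, hx⟩)
      rw [aff_add_smul, haff, hx]
      have := mul_nonpos_of_nonneg_of_nonpos (le_of_lt ht) (sub_nonpos.2 h1.le)
      linarith
    · have hlt := lt_of_le_of_ne (hθ x) hx
      have : Filter.Tendsto (fun t : ℝ => aff (θ + t • η) (toPlane x)) (nhds 0)
          (nhds (aff θ (toPlane x))) := by
        have h2 : Continuous fun t : ℝ => aff (θ + t • η) (toPlane x) := by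
          simp only [aff_add_smul]; fun_prop
        simpa using h2.tendsto 0
      exact nhdsWithin_le_nhds ((this.eventually (gt_mem_nhds hlt)).mono fun t ht => le_of_lt ht)
  obtain ⟨t, ht, ht0⟩ := ((Filter.eventually_all.2 hev).and self_mem_nhdsWithin).exists
  have hinc : aff θ p < aff (θ + t • η) p := by
    rw [aff_add_smul, haff]
    have := mul_pos (show (0 : ℝ) < t from ht0) (sub_pos.2 hf2)
    linarith
  exact absurd (hmax ⟨ht, hθm.trans hinc.le⟩) (not_le.2 hinc)

theorem aff_sub (θ η : ℝ × ℝ × ℝ) (p : ℝ × ℝ) : aff (θ - η) p = aff θ p - aff η p := by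
  simp only [aff, Prod.fst_sub, Prod.snd_sub]
  ring

/-- The zero set on a simplex of a nonnegative affine function is a face. -/
theorem mem_convexHull_zero {s : Finset (ℝ × ℝ)} {θ : ℝ × ℝ × ℝ} (h0 : ∀ q ∈ s, 0 ≤ aff θ q)
    {p : ℝ × ℝ} (hp : p ∈ convexHull ℝ (s : Set (ℝ × ℝ))) (hp0 : aff θ p = 0) :
    p ∈ convexHull ℝ {q | q ∈ s ∧ aff θ q = 0} := by
  classical
  obtain ⟨w, hw0, hw1, hwp⟩ := Finset.mem_convexHull'.1 hp
  have hsum : ∑ q ∈ s, w q * aff θ q = 0 := by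
    rw [← hp0, ← hwp]
    simp only [aff, Prod.fst_sum, Prod.snd_sum, Prod.smul_fst, Prod.smul_snd, smul_eq_mul, mul_add,
      Finset.sum_add_distrib, Finset.mul_sum, ← Finset.sum_mul, hw1, one_mul]
    congr 2 <;> exact Finset.sum_congr rfl fun _ _ => by ring
  have hz := (Finset.sum_eq_zero_iff_of_nonneg fun q hq => mul_nonneg (hw0 q hq) (h0 q hq)).1 hsum
  have hset : {q | q ∈ s ∧ aff θ q = 0} = ((s.filter fun q => aff θ q = 0 : Finset _) : Set _) := by
    ext; simp
  have hw' : ∀ q ∈ s, aff θ q ≠ 0 → w q = 0 := fun q hq hne =>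
    (mul_eq_zero.1 (hz q hq)).resolve_right hne
  rw [hset, Finset.mem_convexHull']
  refine ⟨w, fun q hq => hw0 q (Finset.mem_filter.1 hq).1, ?_, ?_⟩
  · rw [Finset.sum_filter_of_ne, hw1]
    intro q hq hne
    by_contra hc
    exact hne (hw' q hq hc)
  · rw [Finset.sum_filter_of_ne, hwp]
    intro q hq hne
    by_contra hc
    exact hne (by rw [hw' q hq hc, zero_smul])

/-- On a simplex of contact points, a minorant is not exceeded by the other minorants. -/
theorem aff_le_aff_of_mem_convexHull {u : X → ℝ} {θ η : ℝ × ℝ × ℝ} (hη : IsMinorant u η)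
    {s : Set (ℝ × ℝ)} (hs : s ⊆ contact u θ) {p : ℝ × ℝ} (hp : p ∈ convexHull ℝ s) :
    aff η p ≤ aff θ p := by
  have : aff (η - θ) p ≤ 0 := by
    refine aff_le_of_mem_convexHull (fun q hq => ?_) hp
    obtain ⟨x, rfl, hx⟩ := hs hq
    rw [aff_sub, hx]
    linarith [hη x]
  rw [aff_sub] at this
  linarith

/-- The lower faces of the graph of a function, when they are simplices. -/
def lowerComplex (hXf : X.Finite) (u : X → ℝ)
    (hgen : ∀ θ, IsMinorant u θ → AffineIndependent ℝ ((↑) : contact u θ → ℝ × ℝ)) :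
    Geometry.SimplicialComplex ℝ (ℝ × ℝ) where
  faces := {s | s.Nonempty ∧ ∃ θ, IsMinorant u θ ∧ (s : Set (ℝ × ℝ)) ⊆ contact u θ}
  isRelLowerSet_faces := by
    rintro s ⟨hs, θ, hθ, hsθ⟩
    exact ⟨hs, fun t hts ht => ⟨ht, θ, hθ, (Finset.coe_subset.2 hts).trans hsθ⟩⟩
  indep := by
    rintro s ⟨-, θ, hθ, hsθ⟩
    exact (hgen θ hθ).mono hsθ
  inter_subset_convexHull := by
    classical
    rintro s t ⟨-, θ, hθ, hsθ⟩ ⟨-, η, hη, htη⟩ p ⟨hps, hpt⟩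
    -- Over its own simplex each minorant dominates the other, so they agree at `p`. Hence `p` is
    -- carried by the vertices of `s` where `η` also touches `u`; these and `t` are in the single
    -- affinely independent set `contact u η`.
    have heq : aff (θ - η) p = 0 := by
      rw [aff_sub, sub_eq_zero]
      exact le_antisymm (aff_le_aff_of_mem_convexHull hθ htη hpt)
        (aff_le_aff_of_mem_convexHull hη hsθ hps)
    have h1 := mem_convexHull_zero (s := s) (θ := θ - η) (fun q hq => by
      obtain ⟨x, rfl, hx⟩ := hsθ hq
      rw [aff_sub, hx]
      linarith [hη x]) hps heq
    have hsub : ∀ q ∈ s, aff (θ - η) q = 0 → q ∈ contact u η := by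
      intro q hq h
      obtain ⟨x, rfl, hx⟩ := hsθ hq
      refine ⟨x, rfl, ?_⟩
      rw [aff_sub, hx] at h
      linarith
    set s' := s.filter fun q => aff (θ - η) q = 0 with hs'
    have h2 : p ∈ convexHull ℝ (s' : Set (ℝ × ℝ)) := by
      convert h1 using 2
      ext; simp [hs']
    have hfin := finite_contact hXf u η
    have hind : AffineIndependent ℝ ((↑) : hfin.toFinset → ℝ × ℝ) := by
      have := hgen η hη
      exact this.mono (s := (hfin.toFinset : Set (ℝ × ℝ))) (by simp)
    have h3 := hind.convexHull_inter (t₁ := s') (t₂ := t) (fun q hq => by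
      rw [Set.Finite.mem_toFinset]
      exact hsub q (Finset.mem_filter.1 hq).1 (Finset.mem_filter.1 hq).2) (fun q hq => by
      rw [Set.Finite.mem_toFinset]
      exact htη hq)
    have h4 : p ∈ convexHull ℝ ((s' : Set (ℝ × ℝ)) ∩ t) := by
      rw [h3]; exact ⟨h2, hpt⟩
    exact convexHull_mono (Set.inter_subset_inter_left _ (fun q hq => by
      exact (Finset.mem_filter.1 hq).1)) h4

theorem mem_lowerComplex_of_mem_interior (hXf : X.Finite) {u : X → ℝ}
    (hgen : ∀ θ, IsMinorant u θ → AffineIndependent ℝ ((↑) : contact u θ → ℝ × ℝ)) {p : ℝ × ℝ}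
    (hp : p ∈ interior (hull X)) : p ∈ (lowerComplex hXf u hgen).space := by
  obtain ⟨θ, hθ, hpθ⟩ := exists_isMinorant hXf u hp
  have hfin := finite_contact hXf u θ
  refine Geometry.SimplicialComplex.mem_space_iff.2 ⟨hfin.toFinset, ⟨?_, θ, hθ, by simp⟩, by
    simpa using hpθ⟩
  rw [Set.Finite.toFinset_nonempty]
  exact convexHull_nonempty_iff.1 ⟨p, hpθ⟩

/-- The triangulation of `X` by the lower faces of the graph of a function. -/
def lowerTriangulation (hX : LatticeConvex X) (hXf : X.Finite) (hXi : (interior (hull X)).Nonempty)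
    (u : X → ℝ) (hu : PositiveForms X (extend u))
    (hgen : ∀ θ, IsMinorant u θ → AffineIndependent ℝ ((↑) : contact u θ → ℝ × ℝ)) :
    Triangulation X :=
  have hspace : (lowerComplex hXf u hgen).space = hull X := by
    refine Set.Subset.antisymm ?_ ?_
    · intro p hp
      obtain ⟨s, ⟨-, θ, -, hs⟩, hps⟩ := Geometry.SimplicialComplex.mem_space_iff.1 hp
      exact convexHull_mono (hs.trans (contact_subset u θ)) hps
    -- Supporting minorants were found over interior points only; the boundary follows by closure,
    -- the simplices being finite in number.
    · have hclosed : IsClosed (lowerComplex hXf u hgen).space := by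
        refine Set.Finite.isClosed_biUnion ?_ fun s _ => s.finite_toSet.isClosed_convexHull ℝ
        refine Set.Finite.subset (Set.Finite.finite_subsets (hXf.image toPlane)
          |>.preimage (f := fun s : Finset (ℝ × ℝ) => (s : Set (ℝ × ℝ)))
            Finset.coe_injective.injOn) ?_
        rintro s ⟨-, θ, -, hs⟩
        exact hs.trans (contact_subset u θ)
      have h1 := (convex_convexHull ℝ (toPlane '' X)).closure_interior_eq_closure_of_nonempty_interior
        hXi
      intro p hp
      have h2 : p ∈ closure (interior (hull X)) := by
        rw [hull, h1]; exact subset_closure hp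
      exact closure_minimal (fun q hq => mem_lowerComplex_of_mem_interior hXf hgen hq) hclosed h2
  { complex := lowerComplex hXf u hgen
    vertices_eq := by
      refine Set.Subset.antisymm ?_ ?_
      · rintro p ⟨-, θ, -, hs⟩
        exact contact_subset u θ (hs (by simp))
      · rintro _ ⟨x, hx, rfl⟩
        -- The point is in some face, and the maximum principle makes it a contact point of the
        -- corresponding minorant.
        have h1 := toPlane_mem_hull hx
        rw [← hspace, Geometry.SimplicialComplex.mem_space_iff] at h1
        obtain ⟨s, ⟨-, θ, hθ, hs⟩, hps⟩ := h1
        refine ⟨Finset.singleton_nonempty _, θ, hθ, ?_⟩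
        rw [Finset.coe_singleton, Set.singleton_subset_iff]
        exact mem_contact_of_mem_convexHull hX hXf hu hθ (convexHull_mono hs hps)
    space_eq := hspace }

theorem interp_eq_aff (T : Triangulation X) (u : X → ℝ) {s : Finset (ℝ × ℝ)}
    (hs : s ∈ T.complex.faces) {θ : ℝ × ℝ × ℝ}
    (hθ : ∀ x : X, toPlane x ∈ s → aff θ (toPlane x) = u x) {p : ℝ × ℝ}
    (hp : p ∈ convexHull ℝ (s : Set (ℝ × ℝ))) : interp T u p = aff θ p := by
  obtain ⟨A, hA, hU⟩ := interp_spec T u s hs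
  rw [hU p hp]
  have hconv : Convex ℝ {q | A q = aff θ q} := by
    intro x hx y hy a b _ _ hab
    simp only [Set.mem_ofPred_eq] at *
    rw [aff_combo θ x y hab, Convex.combo_affine_apply hab, hx, hy, smul_eq_mul, smul_eq_mul]
  refine convexHull_min (fun q hq => ?_) hconv hp
  obtain ⟨x, rfl⟩ := mem_image_of_mem_face T hs hq
  exact (hA x hq).trans (hθ x hq).symm

/-- The interpolant is the upper envelope of the minorants: it is above all of them, and equal to
one of them on each face. -/
theorem mem_convTriangulation_of_isMinorant (T : Triangulation X) (u : X → ℝ)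
    (h : ∀ s ∈ T.complex.faces, ∃ θ, IsMinorant u θ ∧ (s : Set (ℝ × ℝ)) ⊆ contact u θ) :
    u ∈ convTriangulation T := by
  have heq : ∀ s ∈ T.complex.faces, ∀ θ, (s : Set (ℝ × ℝ)) ⊆ contact u θ →
      ∀ p ∈ convexHull ℝ (s : Set (ℝ × ℝ)), interp T u p = aff θ p := by
    intro s hs θ hsθ p hp
    refine interp_eq_aff T u hs (fun x hx => ?_) hp
    obtain ⟨y, hy, hy'⟩ := hsθ hx
    rw [← hy, hy', Subtype.val_injective (toPlane_injective hy)]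
  have hle : ∀ θ, IsMinorant u θ → ∀ p ∈ hull X, aff θ p ≤ interp T u p := by
    intro θ hθ p hp
    rw [← T.space_eq, Geometry.SimplicialComplex.mem_space_iff] at hp
    obtain ⟨s, hs, hps⟩ := hp
    obtain ⟨η, -, hsη⟩ := h s hs
    rw [heq s hs η hsη p hps]
    exact aff_le_aff_of_mem_convexHull hθ hsη hps
  refine ⟨convex_convexHull ℝ _, fun p hp q hq a b ha hb hab => ?_⟩
  have hpq := (convex_convexHull ℝ _) hp hq ha hb hab
  have hpq' : a • p + b • q ∈ T.complex.space := by rw [T.space_eq]; exact hpq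
  obtain ⟨s, hs, hps⟩ := Geometry.SimplicialComplex.mem_space_iff.1 hpq'
  obtain ⟨θ, hθ, hsθ⟩ := h s hs
  rw [heq s hs θ hsθ _ hps, aff_combo θ p q hab, smul_eq_mul, smul_eq_mul]
  have := hle θ hθ p hp
  have := hle θ hθ q hq
  gcongr

end Lower

/-! ### From stencils to triangulations -/

section Inclusion

variable {X : Set (ℤ × ℤ)}

theorem exists_isIrred_smul {e : ℤ × ℤ} (he : e ≠ 0) :
    ∃ (g : ℤ) (m : ℤ × ℤ), 1 ≤ g ∧ IsIrred m ∧ e = g • m := by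
  have hg0 : 0 < Int.gcd e.1 e.2 := by
    refine Nat.pos_of_ne_zero fun h0 => he ?_
    obtain ⟨h1, h2⟩ := Int.gcd_eq_zero_iff.1 h0
    exact Prod.ext h1 h2
  obtain ⟨m, n, hmn, h1, h2⟩ := Int.exists_gcd_one hg0
  refine ⟨Int.gcd e.1 e.2, (m, n), Int.natCast_pos.2 hg0, hmn, ?_⟩
  exact Prod.ext (h1.trans (mul_comm _ _)) (h2.trans (mul_comm _ _))

/-- An imprimitive edge would carry three equally spaced contact points, against `S > 0`. For a
primitive edge outside the stencil, equality at `x` and `x + e` and the minorant bound at `x + f`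
and `x + g` give `P ≤ 0`, against `formP_pos`. -/
theorem lowerTriangulation_prec (hX : LatticeConvex X) (hXf : X.Finite)
    (hXi : (interior (hull X)).Nonempty) (V : Stencils X) {u : X → ℝ}
    (huV : u ∈ interior (convStencils V)) (hu : PositiveForms X (extend u))
    (hgen : ∀ θ, IsMinorant u θ → AffineIndependent ℝ ((↑) : contact u θ → ℝ × ℝ)) :
    (lowerTriangulation hX hXf hXi u hu hgen).Prec V := by
  rintro x e he0 ⟨-, θ, hθ, hsub⟩
  rw [Finset.coe_pair] at hsub
  have hconv : ∀ z, toPlane z ∈ convexHull ℝ {toPlane x, toPlane (x + e)} →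
      ∃ h : z ∈ X, aff θ (toPlane z) = u ⟨z, h⟩ := by
    intro z hz
    obtain ⟨y, hy, hy'⟩ := mem_contact_of_mem_convexHull hX hXf hu hθ (convexHull_mono hsub hz)
    obtain rfl := toPlane_injective hy
    exact ⟨y.2, hy'⟩
  obtain ⟨_, hx⟩ := hconv x (subset_convexHull ℝ _ (by simp))
  obtain ⟨heX, hxe⟩ := hconv (x + e) (subset_convexHull ℝ _ (by simp))
  obtain ⟨g, m, hg, hm, hgm⟩ := exists_isIrred_smul he0
  have hmul : ∀ k : ℤ, 0 ≤ k → k ≤ g → toPlane (x + k • m) ∈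
      convexHull ℝ {toPlane x, toPlane (x + e)} := by
    intro k h0 hk
    refine toPlane_mem_of_convex (convex_convexHull ℝ _) (a := x) (b := x + e) (c := x)
      (subset_convexHull ℝ _ (by simp)) (subset_convexHull ℝ _ (by simp))
      (subset_convexHull ℝ _ (by simp)) (i := g - k) (j := k) (k := 0) (n := g) (by omega) h0 le_rfl
      (by omega) (by ring) ?_ ?_
    · rw [hgm]; simp only [Prod.fst_add, Prod.smul_fst, smul_eq_mul]; ring
    · rw [hgm]; simp only [Prod.snd_add, Prod.smul_snd, smul_eq_mul]; ring
  have hirr : IsIrred e := by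
    by_cases h1 : g = 1
    · rw [hgm, h1, one_smul]; exact hm
    exfalso
    obtain ⟨h1X, h1⟩ := hconv _ (hmul 1 (by omega) (by omega))
    obtain ⟨h2X, h2⟩ := hconv _ (hmul 2 (by omega) (by omega))
    have e1 : (x : ℤ × ℤ) + (1 : ℤ) • m + m = x + (2 : ℤ) • m := by module
    have e2 : (x : ℤ × ℤ) + (1 : ℤ) • m - m = x := by module
    have h3 := hu.1 _ m hm h1X (by rw [e1]; exact h2X) (by rw [e2]; exact x.2)
    rw [formS, e1, e2, extend_of_mem u h1X, extend_of_mem u h2X, extend_apply, ← h1, ← h2,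
      ← hx] at h3
    simp only [aff, toPlane, Prod.fst_add, Prod.snd_add, Prod.smul_fst, Prod.smul_snd,
      smul_eq_mul] at h3
    push_cast at h3
    linarith
  by_contra hne
  have hemax : e ∈ maxStencil X x := ⟨hirr, heX⟩
  have hgt : 1 < dot e e := by
    have h3 := dot_self_pos he0
    by_contra! h4
    exact hne (V.mem_of_dot_eq_one hX x hemax (by omega))
  obtain ⟨f, g', hp⟩ := exists_isParents hirr hgt
  obtain ⟨hf, hg'⟩ := V.parents_mem hX hXf x hemax hne hp
  have h5 := formP_pos hX hXf V huV heX hne hp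
  rw [formP, extend_of_mem u heX, extend_of_mem u hf.2, extend_of_mem u hg'.2, extend_apply, ← hxe,
    ← hx] at h5
  have h6 := hθ ⟨_, hf.2⟩
  have h7 := hθ ⟨_, hg'.2⟩
  have := hp.eq_add
  simp only [this, aff, toPlane, Prod.fst_add, Prod.snd_add] at h5 h6 h7
  push_cast at h5 h6 h7
  linarith

theorem exists_affine_dependency {E : Set X}
    (hE : ¬ AffineIndependent ℝ (fun x : E => toPlane x)) :
    ∃ (s : Finset X) (c : X → ℝ), (∀ x ∈ s, x ∈ E) ∧ ∑ x ∈ s, c x = 0 ∧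
      ∑ x ∈ s, c x • toPlane x = 0 ∧ ∃ x ∈ s, c x ≠ 0 := by
  rw [affineIndependent_iff] at hE
  push Not at hE
  obtain ⟨s, w, h1, h2, x, hx, hwx⟩ := hE
  have hext : ∀ y : E, Function.extend Subtype.val w 0 (y : X) = w y := fun y =>
    Subtype.val_injective.extend_apply w 0 y
  refine ⟨s.map (Function.Embedding.subtype _), Function.extend Subtype.val w 0, ?_, ?_, ?_, x, ?_,
    ?_⟩
  · intro y hy
    obtain ⟨z, -, rfl⟩ := Finset.mem_map.1 hy
    exact z.2
  · simpa [hext] using h1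
  · simpa [hext] using h2
  · simpa using hx
  · rwa [hext]

theorem dense_sum_ne_zero {ι : Type*} (s : Finset ι) (c : ι → ℝ) (h : ∃ x ∈ s, c x ≠ 0) :
    Dense {u : ι → ℝ | ∑ x ∈ s, c x * u x ≠ 0} := by
  classical
  obtain ⟨x, hx, hcx⟩ := h
  intro u
  by_cases hu : ∑ x ∈ s, c x * u x = 0
  · have hcont : Continuous fun t : ℝ => u + t • Pi.single x (1 : ℝ) := by fun_prop
    have htend : Filter.Tendsto (fun t : ℝ => u + t • Pi.single x (1 : ℝ))
        (nhdsWithin 0 {0}ᶜ) (nhds u) := by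
      have := hcont.tendsto 0
      simp only [zero_smul, add_zero] at this
      exact this.mono_left nhdsWithin_le_nhds
    refine mem_closure_of_tendsto htend ?_
    filter_upwards [self_mem_nhdsWithin] with t ht
    have : ∑ y ∈ s, c y * (u + t • Pi.single x (1 : ℝ) : ι → ℝ) y = c x * t := by
      simp only [Pi.add_apply, Pi.smul_apply, smul_eq_mul, mul_add, Finset.sum_add_distrib, hu,
        zero_add, Pi.single_apply, mul_ite, mul_one, mul_zero]
      rw [Finset.sum_ite_eq' s x, if_pos hx]
    rw [this]
    exact mul_ne_zero hcx ht
  · exact subset_closure hu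

/-- The contact sets of a generic function are affinely independent. -/
theorem exists_dense_affineIndependent (hXf : X.Finite) :
    ∃ G : Set (X → ℝ), Dense G ∧ ∀ u ∈ G, ∀ θ,
      AffineIndependent ℝ ((↑) : contact u θ → ℝ × ℝ) := by
  have : Finite X := hXf
  have : Fintype X := Fintype.ofFinite X
  choose s c hsE h1 h2 h3 using fun E : {E : Set X // ¬ AffineIndependent ℝ
    (fun x : E => toPlane x)} => exists_affine_dependency E.2
  -- Each affinely dependent subset of `X` gives one hyperplane to be avoided.
  refine ⟨⋂ E, {u : X → ℝ | ∑ x ∈ s E, c E x * u x ≠ 0}, dense_iInter_of_isOpen (fun E => ?_)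
    (fun E => dense_sum_ne_zero _ _ (h3 E)), fun u hu θ => ?_⟩
  · exact isOpen_ne_fun (by fun_prop) continuous_const
  set F : Set X := {x | aff θ (toPlane x) = u x} with hF
  have hind : AffineIndependent ℝ (fun x : F => toPlane x) := by
    -- On a contact set `u` is affine, so an affine dependency of the points would annihilate its
    -- values.
    by_contra hcon
    refine Set.mem_iInter.1 hu ⟨F, hcon⟩ ?_
    have e1 : ∑ x ∈ s ⟨F, hcon⟩, c ⟨F, hcon⟩ x * u x
        = ∑ x ∈ s ⟨F, hcon⟩, c ⟨F, hcon⟩ x * aff θ (toPlane x) :=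
      Finset.sum_congr rfl fun x hx => by rw [show aff θ (toPlane x) = u x from hsE _ x hx]
    have e2 := congrArg Prod.fst (h2 ⟨F, hcon⟩)
    have e3 := congrArg Prod.snd (h2 ⟨F, hcon⟩)
    simp only [Prod.fst_sum, Prod.snd_sum, Prod.smul_fst, Prod.smul_snd, smul_eq_mul, Prod.fst_zero,
      Prod.snd_zero] at e2 e3
    rw [e1]
    have e4 : ∀ x : X, c ⟨F, hcon⟩ x * aff θ (toPlane x) =
        θ.1 * (c ⟨F, hcon⟩ x * (toPlane x).1) + θ.2.1 * (c ⟨F, hcon⟩ x * (toPlane x).2)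
          + θ.2.2 * c ⟨F, hcon⟩ x := fun x => by simp only [aff]; ring
    simp only [e4, Finset.sum_add_distrib, ← Finset.mul_sum, e2, e3, h1, mul_zero, add_zero]
  refine hind.range.mono ?_
  rintro _ ⟨x, rfl, hx⟩
  exact ⟨⟨x, hx⟩, rfl⟩

theorem interp_vertex (T : Triangulation X) (u : X → ℝ) (x : X) : interp T u (toPlane x) = u x := by
  have hx : toPlane x ∈ T.complex.vertices := by
    rw [T.vertices_eq]; exact ⟨x, x.2, rfl⟩
  obtain ⟨A, hA, hU⟩ := interp_spec T u {toPlane x} hx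
  rw [hU _ (subset_convexHull ℝ _ (by simp)), hA x (by simp)]

theorem interp_combo (T : Triangulation X) (u : X → ℝ) {s : Finset (ℝ × ℝ)}
    (hs : s ∈ T.complex.faces) {p q : ℝ × ℝ} (hp : p ∈ convexHull ℝ (s : Set (ℝ × ℝ)))
    (hq : q ∈ convexHull ℝ (s : Set (ℝ × ℝ))) {a b : ℝ} (ha : 0 ≤ a) (hb : 0 ≤ b)
    (hab : a + b = 1) : interp T u (a • p + b • q) = a * interp T u p + b * interp T u q := by
  obtain ⟨A, -, hU⟩ := interp_spec T u s hs
  rw [hU _ (convex_convexHull ℝ _ hp hq ha hb hab), hU p hp, hU q hq,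
    Convex.combo_affine_apply hab, smul_eq_mul, smul_eq_mul]

/-- At a fixed point the interpolant is a fixed convex combination of values of `u`. -/
theorem continuous_interp (T : Triangulation X) {p : ℝ × ℝ} (hp : p ∈ hull X) :
    Continuous fun u => interp T u p := by
  rw [← T.space_eq, Geometry.SimplicialComplex.mem_space_iff] at hp
  obtain ⟨s, hs, hps⟩ := hp
  have hconv : Convex ℝ {p | p ∈ convexHull ℝ (s : Set (ℝ × ℝ)) ∧
      Continuous fun u => interp T u p} := by
    rintro p ⟨hp, hp'⟩ q ⟨hq, hq'⟩ a b ha hb hab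
    refine ⟨convex_convexHull ℝ _ hp hq ha hb hab, ?_⟩
    simp only [interp_combo T _ hs hp hq ha hb hab]
    fun_prop
  refine (convexHull_min (fun q hq => ?_) hconv hps).2
  refine ⟨subset_convexHull ℝ _ hq, ?_⟩
  obtain ⟨x, rfl⟩ := mem_image_of_mem_face T hs hq
  simp only [interp_vertex]
  fun_prop

theorem isClosed_convTriangulation (T : Triangulation X) : IsClosed (convTriangulation T) := by
  have hc : Convex ℝ (hull X) := convex_convexHull ℝ _
  have heq : convTriangulation T = ⋂ (p : hull X) (q : hull X) (a : ℝ) (b : ℝ) (_ : 0 ≤ a)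
      (_ : 0 ≤ b) (_ : a + b = 1),
        {u | interp T u (a • (p : ℝ × ℝ) + b • (q : ℝ × ℝ)) ≤
          a * interp T u p + b * interp T u q} := by
    ext u
    simp only [convTriangulation, ConvexOn, Set.mem_ofPred_eq, Set.mem_iInter, hc, true_and,
      Subtype.forall, smul_eq_mul]
  rw [heq]
  refine isClosed_iInter fun p => isClosed_iInter fun q => isClosed_iInter fun a =>
    isClosed_iInter fun b => isClosed_iInter fun ha => isClosed_iInter fun hb =>
    isClosed_iInter fun hab => isClosed_le (continuous_interp T (hc p.2 q.2 ha hb hab)) ?_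
  exact (continuous_const.mul (continuous_interp T p.2)).add
    (continuous_const.mul (continuous_interp T q.2))

theorem finite_triangulation (hXf : X.Finite) : Finite (Triangulation X) := by
  have hfin : {s : Finset (ℝ × ℝ) | (s : Set (ℝ × ℝ)) ⊆ toPlane '' X}.Finite :=
    ((hXf.image toPlane).finite_subsets.preimage
      (f := fun s : Finset (ℝ × ℝ) => (s : Set (ℝ × ℝ))) Finset.coe_injective.injOn)
  rw [← Set.finite_univ_iff]
  refine Set.Finite.of_finite_image (f := fun T : Triangulation X => T.complex.faces) ?_ ?_
  · refine hfin.finite_subsets.subset ?_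
    rintro _ ⟨T, -, rfl⟩ s hs p hp
    obtain ⟨x, rfl⟩ := mem_image_of_mem_face T hs hp
    exact ⟨x, x.2, rfl⟩
  · rintro ⟨K, h1, h2⟩ - ⟨K', h1', h2'⟩ - h
    have : K = K' := Geometry.SimplicialComplex.ext h
    subst this
    rfl

theorem convStencils_subset_iUnion (hX : LatticeConvex X) (hXf : X.Finite)
    (hXi : (interior (hull X)).Nonempty) (V : Stencils X)
    (hV : (interior (convStencils V)).Nonempty) :
    convStencils V ⊆ ⋃ (T : Triangulation X) (_ : T.Prec V), convTriangulation T := by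
  have := finite_triangulation hXf
  obtain ⟨G, hG, hGind⟩ := exists_dense_affineIndependent hXf
  have hclosed : IsClosed (⋃ (T : Triangulation X) (_ : T.Prec V), convTriangulation T) :=
    Set.Finite.isClosed_biUnion (Set.toFinite {T : Triangulation X | T.Prec V})
      fun T _ => isClosed_convTriangulation T
  -- Two approximations follow: of the cone by its interior, then of the interior by its generic
  -- elements.
  have h1 := (convex_convStencils V).closure_interior_eq_closure_of_nonempty_interior hV
  rw [(isClosed_convStencils V).closure_eq] at h1
  have h2 := hG.open_subset_closure_inter (isOpen_interior (s := convStencils V))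
  refine h1.symm.subset.trans (closure_minimal (h2.trans (closure_minimal ?_ hclosed)) hclosed)
  rintro u ⟨huV, huG⟩
  have hpos : PositiveForms X (extend u) :=
    ⟨fun x e he => formS_pos hX hXf V huV he, fun x e f g hp => formT_pos hX hXf V huV hp⟩
  have hgen : ∀ θ, IsMinorant u θ → AffineIndependent ℝ ((↑) : contact u θ → ℝ × ℝ) :=
    fun θ _ => hGind u huG θ
  refine Set.mem_iUnion₂.2 ⟨lowerTriangulation hX hXf hXi u hpos hgen,
    lowerTriangulation_prec hX hXf hXi V huV hpos hgen,
    mem_convTriangulation_of_isMinorant _ u fun s hs => hs.2⟩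

end Inclusion

/-! ### From triangulations to stencils -/

section Converse

variable {X : Set (ℤ × ℤ)}

theorem toPlane_le_of_convexOn {C : Set (ℝ × ℝ)} {U : ℝ × ℝ → ℝ} (hU : ConvexOn ℝ C U)
    {a b c z : ℤ × ℤ} {i j k n : ℤ} (ha : toPlane a ∈ C) (hb : toPlane b ∈ C) (hc : toPlane c ∈ C)
    (hi : 0 ≤ i) (hj : 0 ≤ j) (hk : 0 ≤ k) (hn : 0 < n) (hs : i + j + k = n)
    (h1 : n * z.1 = i * a.1 + j * b.1 + k * c.1) (h2 : n * z.2 = i * a.2 + j * b.2 + k * c.2) :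
    n * U (toPlane z) ≤ i * U (toPlane a) + j * U (toPlane b) + k * U (toPlane c) := by
  have hn' : (0 : ℝ) < n := by exact_mod_cast hn
  have h := hU.map_sum_le (t := Finset.univ) (w := ![(i : ℝ) / n, j / n, k / n])
    (p := ![toPlane a, toPlane b, toPlane c]) ?_ ?_ ?_
  · have h1' : (n : ℝ) * z.1 = i * a.1 + j * b.1 + k * c.1 := by exact_mod_cast h1
    have h2' : (n : ℝ) * z.2 = i * a.2 + j * b.2 + k * c.2 := by exact_mod_cast h2
    have hz : toPlane z = ∑ m, ![(i : ℝ) / n, j / n, k / n] m •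
        ![toPlane a, toPlane b, toPlane c] m := by
      simp only [Fin.sum_univ_three]
      ext
      · simp [toPlane]; field_simp; linarith
      · simp [toPlane]; field_simp; linarith
    rw [← hz] at h
    simp only [Fin.sum_univ_three] at h
    simp only [Matrix.cons_val, smul_eq_mul] at h
    have h3 := mul_le_mul_of_nonneg_left h hn'.le
    refine h3.trans (le_of_eq ?_)
    field_simp
  · have hi' : (0 : ℝ) ≤ i := by exact_mod_cast hi
    have hj' : (0 : ℝ) ≤ j := by exact_mod_cast hj
    have hk' : (0 : ℝ) ≤ k := by exact_mod_cast hk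
    intro m _
    fin_cases m <;> simp <;> positivity
  · simp only [Fin.sum_univ_three]
    have hs' : (i : ℝ) + j + k = n := by exact_mod_cast hs
    simp; field_simp; linarith
  · intro m _
    fin_cases m <;> simpa

theorem singleton_mem_faces (T : Triangulation X) (x : X) :
    ({toPlane x} : Finset (ℝ × ℝ)) ∈ T.complex.faces := by
  have hx : toPlane x ∈ T.complex.vertices := by
    rw [T.vertices_eq]; exact ⟨x, x.2, rfl⟩
  exact hx

/-- Such a point is itself a vertex of `T`, and two faces meet only in the hull of their common
vertices. -/
theorem mem_of_toPlane_mem_convexHull (hX : LatticeConvex X) (T : Triangulation X)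
    {s : Finset (ℝ × ℝ)} (hs : s ∈ T.complex.faces) {z : ℤ × ℤ}
    (hz : toPlane z ∈ convexHull ℝ (s : Set (ℝ × ℝ))) : toPlane z ∈ s := by
  have hzX : z ∈ X := by
    refine hX z ?_
    rw [← T.space_eq]
    exact T.complex.convexHull_subset_space hs hz
  have h := T.complex.inter_subset_convexHull hs (singleton_mem_faces T ⟨z, hzX⟩)
    ⟨hz, subset_convexHull ℝ _ (by simp)⟩
  by_contra hcon
  have hempty : (s : Set (ℝ × ℝ)) ∩ (({toPlane z} : Finset (ℝ × ℝ)) : Set (ℝ × ℝ)) = ∅ := by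
    ext q
    simp only [Set.mem_inter_iff, Finset.mem_coe, Finset.mem_singleton, Set.mem_empty_iff_false,
      iff_false, not_and]
    rintro hq rfl
    exact hcon hq
  rw [hempty, convexHull_empty] at h
  exact h

theorem finite_faces (hXf : X.Finite) (T : Triangulation X) : T.complex.faces.Finite := by
  refine ((hXf.image toPlane).finite_subsets.preimage
    (f := fun s : Finset (ℝ × ℝ) => (s : Set (ℝ × ℝ))) Finset.coe_injective.injOn).subset ?_
  intro s hs p hp
  obtain ⟨x, rfl⟩ := mem_image_of_mem_face T hs hp
  exact ⟨x, x.2, rfl⟩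

/-- Each direction which points from `x` to a point of `X` starts in a face with vertex `x`. -/
theorem exists_face_of_direction (hX : LatticeConvex X) (hXf : X.Finite) (T : Triangulation X)
    (x : X) {e : ℤ × ℤ} (he : (x : ℤ × ℤ) + e ∈ X) :
    ∃ s ∈ T.complex.faces, toPlane x ∈ s ∧ ∃ ε : ℝ, 0 < ε ∧ ε ≤ 1 ∧
      toPlane x + ε • toPlane e ∈ convexHull ℝ (s : Set (ℝ × ℝ)) := by
  -- The faces avoiding `x` have a closed union, which the beginning of the ray therefore misses.
  set F : Set (ℝ × ℝ) := ⋃ s ∈ {s | s ∈ T.complex.faces ∧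
    toPlane x ∉ convexHull ℝ (s : Set (ℝ × ℝ))}, convexHull ℝ (s : Set (ℝ × ℝ)) with hF
  have hclosed : IsClosed F :=
    ((finite_faces hXf T).subset fun s hs => hs.1).isClosed_biUnion
      fun s _ => s.finite_toSet.isClosed_convexHull ℝ
  have hxF : toPlane x ∉ F := by
    simp only [hF, Set.mem_iUnion, not_exists]
    exact fun s hs => hs.2
  have htend : Filter.Tendsto (fun t : ℝ => toPlane x + t • toPlane e)
      (nhdsWithin 0 (Set.Ioi 0)) (nhds (toPlane x)) := by
    have h : Continuous fun t : ℝ => toPlane (x : ℤ × ℤ) + t • toPlane e := by fun_prop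
    have := h.tendsto 0
    simp only [zero_smul, add_zero] at this
    exact this.mono_left nhdsWithin_le_nhds
  have h1 := htend.eventually (hclosed.isOpen_compl.mem_nhds hxF)
  have h2 : ∀ᶠ t in nhdsWithin (0 : ℝ) (Set.Ioi 0), t ≤ 1 :=
    nhdsWithin_le_nhds (Iic_mem_nhds one_pos)
  obtain ⟨ε, ⟨h3, h4⟩, h5⟩ := ((h1.and h2).and self_mem_nhdsWithin).exists
  have h5' : (0 : ℝ) < ε := h5
  have hmem : toPlane x + ε • toPlane e ∈ T.complex.space := by
    rw [T.space_eq]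
    have := (convex_convexHull ℝ (toPlane '' X)) (toPlane_mem_hull x.2) (toPlane_mem_hull he)
      (sub_nonneg.2 h4) h5'.le (by ring)
    have h6 : (1 - ε) • toPlane (x : ℤ × ℤ) + ε • toPlane (x + e) = toPlane x + ε • toPlane e := by
      rw [toPlane_add]; module
    rwa [h6] at this
  obtain ⟨s, hs, hps⟩ := Geometry.SimplicialComplex.mem_space_iff.1 hmem
  refine ⟨s, hs, mem_of_toPlane_mem_convexHull hX T hs ?_, ε, h5', h4, hps⟩
  by_contra hcon
  exact h3 (Set.mem_biUnion (show s ∈ {s | s ∈ T.complex.faces ∧ _} from ⟨hs, hcon⟩) hps)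

/-- The parallelogram inequality for a convex function, near a unimodular triangle on which it is
affine and the cone of which contains the parallelogram. -/
theorem formP_nonneg_of_cone {U : ℝ × ℝ → ℝ} (hU : ConvexOn ℝ (hull X) U) {x a b e f g : ℤ × ℤ}
    (ha : x + a ∈ X) (hb : x + b ∈ X) (he : x + e ∈ X) (hab : cross a b = 1)
    (hp : IsParents f g e) (h1 : 0 ≤ cross f b) (h2 : 0 ≤ cross a f) (h3 : 0 ≤ cross g b)
    (h4 : 0 ≤ cross a g)
    (hext : U (toPlane x) + cross e b * (U (toPlane (x + a)) - U (toPlane x))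
      + cross a e * (U (toPlane (x + b)) - U (toPlane x)) ≤ U (toPlane (x + e))) :
    0 ≤ formP x e f g (fun z => U (toPlane z)) := by
  have hfg := hp.cross_eq
  have hefg := hp.eq_add
  have hd : cross f b * cross a g - cross g b * cross a f = 1 := by
    have : cross f b * cross a g - cross g b * cross a f = cross a b * cross f g := by
      simp only [cross]; ring
    rw [this, hab, hfg, one_mul]
  have hf1 : f.1 = cross f b * a.1 + cross a f * b.1 := by
    simp only [cross] at *; linear_combination -f.1 * hab
  have hf2 : f.2 = cross f b * a.2 + cross a f * b.2 := by
    simp only [cross] at *; linear_combination -f.2 * hab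
  have hg1 : g.1 = cross g b * a.1 + cross a g * b.1 := by
    simp only [cross] at *; linear_combination -g.1 * hab
  have hg2 : g.2 = cross g b * a.2 + cross a g * b.2 := by
    simp only [cross] at *; linear_combination -g.2 * hab
  have hP : cross e b = cross f b + cross g b := by
    rw [hefg]; simp only [cross, Prod.fst_add, Prod.snd_add]; ring
  have hQ : cross a e = cross a f + cross a g := by
    rw [hefg]; simp only [cross, Prod.fst_add, Prod.snd_add]; ring
  rw [hP, hQ] at hext
  generalize cross f b = p₁ at *
  generalize cross a f = q₁ at *
  generalize cross g b = p₂ at *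
  generalize cross a g = q₂ at *
  have hpq : 1 ≤ p₁ * q₂ := by have := mul_nonneg h3 h2; omega
  have hp1 : 1 ≤ p₁ := by
    by_contra hc
    have : p₁ = 0 := by omega
    simp [this] at hpq
  have hq2 : 1 ≤ q₂ := by
    by_contra hc
    have : q₂ = 0 := by omega
    simp [this] at hpq
  -- Both `x + f` and `x + g` are in the triangle `x + a, x + b, x + e`, whose doubled area is `n`.
  -- The weights of the two inequalities add up to `p₁ + p₂`, `q₁ + q₂`, `n - 1`; with `hext`, this
  -- is `n` times the claim.
  have i1 := toPlane_le_of_convexOn hU (toPlane_mem_hull ha) (toPlane_mem_hull hb)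
    (toPlane_mem_hull he) (z := x + f) (i := 1 + p₂) (j := q₂ - 1) (k := p₁ + q₁ - 1)
    (n := p₁ + p₂ + q₁ + q₂ - 1) (by omega) (by omega) (by omega) (by omega) (by ring)
    (by simp only [hefg, Prod.fst_add, hf1, hg1]; linear_combination (a.1 - b.1) * hd)
    (by simp only [hefg, Prod.snd_add, hf2, hg2]; linear_combination (a.2 - b.2) * hd)
  have i2 := toPlane_le_of_convexOn hU (toPlane_mem_hull ha) (toPlane_mem_hull hb)
    (toPlane_mem_hull he) (z := x + g) (i := p₁ - 1) (j := 1 + q₁) (k := p₂ + q₂ - 1)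
    (n := p₁ + p₂ + q₁ + q₂ - 1) (by omega) (by omega) (by omega) (by omega) (by ring)
    (by simp only [hefg, Prod.fst_add, hf1, hg1]; linear_combination (b.1 - a.1) * hd)
    (by simp only [hefg, Prod.snd_add, hf2, hg2]; linear_combination (b.2 - a.2) * hd)
  have hn : (0 : ℝ) < (p₁ + p₂ + q₁ + q₂ - 1 : ℤ) := by
    exact_mod_cast (by omega : 0 < p₁ + p₂ + q₁ + q₂ - 1)
  have key : 0 ≤ ((p₁ + p₂ + q₁ + q₂ - 1 : ℤ) : ℝ) *
      formP x e f g (fun z => U (toPlane z)) := by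
    simp only [formP]
    push_cast at *
    linarith
  exact nonneg_of_mul_nonneg_right key hn

/-- Two adjacent elements of a stencil around a vector outside of this stencil surround its
parents. -/
theorem cross_nonneg_of_adjacent {a b e f g : ℤ × ℤ} (hp : IsParents f g e) (hab : cross a b = 1)
    (h1 : 1 ≤ cross e b) (h2 : 1 ≤ cross a e) (ha : cross a g ≤ 0 ∨ cross f a ≤ 0)
    (hb : cross b g ≤ 0 ∨ cross f b ≤ 0) :
    0 ≤ cross f b ∧ 0 ≤ cross a f ∧ 0 ≤ cross g b ∧ 0 ≤ cross a g := by
  have hfg := hp.cross_eq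
  have hefg := hp.eq_add
  have hP : cross e b = cross f b - cross b g := by
    rw [hefg]; simp only [cross, Prod.fst_add, Prod.snd_add]; ring
  have hQ : cross a e = cross a g - cross f a := by
    rw [hefg]; simp only [cross, Prod.fst_add, Prod.snd_add]; ring
  have i1 : cross e b * cross a g + cross a e * cross b g = 1 := by
    have : cross e b * cross a g + cross a e * cross b g = cross a b * cross f g := by
      rw [hefg]; simp only [cross, Prod.fst_add, Prod.snd_add]; ring
    rw [this, hab, hfg, one_mul]
  have i2 : cross e b * cross f a + cross a e * cross f b = 1 := by
    have : cross e b * cross f a + cross a e * cross f b = cross a b * cross f g := by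
      rw [hefg]; simp only [cross, Prod.fst_add, Prod.snd_add]; ring
    rw [this, hab, hfg, one_mul]
  have e1 : cross a f = -cross f a := by simp only [cross]; ring
  have e2 : cross g b = -cross b g := by simp only [cross]; ring
  -- If instead `cross a g ≤ 0`, then `hQ` and `1 ≤ cross a e` still give this sign. The identities
  -- `i1` and `i2` force the other two signs.
  have k1 : cross f a ≤ 0 := by rcases ha with h | h <;> omega
  have k2 : cross b g ≤ 0 := by rcases hb with h | h <;> omega
  refine ⟨?_, by omega, by omega, ?_⟩ <;> by_contra! hneg <;> nlinarith

theorem interp_triple (T : Triangulation X) (u : X → ℝ) {s : Finset (ℝ × ℝ)}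
    (hs : s ∈ T.complex.faces) {p q r : ℝ × ℝ} (hp : p ∈ s) (hq : q ∈ s) (hr : r ∈ s) {a b c : ℝ}
    (habc : a + b + c = 1) (h : a • p + b • q + c • r ∈ convexHull ℝ (s : Set (ℝ × ℝ))) :
    interp T u (a • p + b • q + c • r) = a * interp T u p + b * interp T u q + c * interp T u r := by
  obtain ⟨A, -, hU⟩ := interp_spec T u s hs
  have hsub := subset_convexHull ℝ (s : Set (ℝ × ℝ))
  rw [hU _ h, hU p (hsub hp), hU q (hsub hq), hU r (hsub hr), AffineMap.decomp A]
  simp only [Pi.add_apply, map_add, map_smul, smul_eq_mul]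
  linear_combination (-A 0) * habc

/-- The face at `x` in the direction `e` is shown to be a unimodular triangle with `e` strictly
inside its angle. Its two edges at `x` are in the stencil, so they enclose the parents of `e`. -/
theorem formP_nonneg_of_prec (hX : LatticeConvex X) (hXf : X.Finite) (V : Stencils X)
    (T : Triangulation X) (hT : T.Prec V) {u : X → ℝ} (hu : u ∈ convTriangulation T) (x : X)
    {e f g : ℤ × ℤ} (he : e ∈ maxStencil X x) (hne : e ∉ V.at' x) (hp : IsParents f g e) :
    0 ≤ formP x e f g (fun z => interp T u (toPlane z)) := by
  obtain ⟨s, hs, hxs, ε, hε0, hε1, hεs⟩ := exists_face_of_direction hX hXf T x he.2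
  have hsub := subset_convexHull ℝ (s : Set (ℝ × ℝ))
  have hmemX : ∀ a, toPlane (x + a) ∈ s → (x : ℤ × ℤ) + a ∈ X := by
    intro a ha
    obtain ⟨y, hy⟩ := mem_image_of_mem_face T hs ha
    rw [← toPlane_injective hy]; exact y.2
  have hedge : ∀ a, toPlane (x + a) ∈ s → a ≠ 0 → a ∈ V.at' x := by
    intro a ha ha0
    refine hT x a ha0 (T.complex.down_closed hs ?_ (by simp))
    intro q hq
    rcases Finset.mem_insert.1 hq with rfl | hq
    · exact hxs
    · rw [Finset.mem_singleton.1 hq]; exact ha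
  -- A vertex in the direction `e` would be `x + k • e` with `k ≥ 1`. Then `x + e` would be in the
  -- face, hence a vertex of it, and `e` in the stencil.
  have hpar : ∀ a, toPlane (x + a) ∈ s → cross e a = 0 → 0 < dot e a → False := by
    intro a ha h0 hd
    obtain ⟨m, n, hmn⟩ := isIrred_iff.1 he.1
    set k := m * a.1 + n * a.2 with hk
    simp only [cross] at h0
    have e1 : a.1 = k * e.1 := by rw [hk]; linear_combination (-a.1) * hmn - n * h0
    have e2 : a.2 = k * e.2 := by rw [hk]; linear_combination (-a.2) * hmn + m * h0
    have hk0 : 1 ≤ k := by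
      by_contra hc
      have : dot e a = k * dot e e := by simp only [dot]; rw [e1, e2]; ring
      have h3 := dot_self_nonneg e
      nlinarith
    have hxe : toPlane (x + e) ∈ s := by
      refine mem_of_toPlane_mem_convexHull hX T hs (toPlane_mem_of_convex (convex_convexHull ℝ _)
        (hsub hxs) (hsub ha) (hsub ha) (i := k - 1) (j := 1) (k := 0) (n := k) (by omega)
        zero_le_one le_rfl (by omega) (by ring) ?_ ?_)
      · simp only [Prod.fst_add]; linear_combination -e1
      · simp only [Prod.snd_add]; linear_combination -e2
    exact hne (hedge e hxe he.1.ne_zero)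
  obtain ⟨q, r, hqr⟩ : ∃ q r, (s : Set (ℝ × ℝ)) = {toPlane x, q, r} := by
    obtain ⟨p, q, r, h⟩ := exists_eq_triple (T.complex.indep hs) ⟨_, hxs⟩
    have hx' : toPlane x ∈ (s : Set (ℝ × ℝ)) := hxs
    rw [h] at hx' ⊢
    rcases hx' with hx' | hx' | hx'
    · exact ⟨q, r, by rw [hx']⟩
    · exact ⟨p, r, by rw [hx', Set.insert_comm]⟩
    · rw [Set.mem_singleton_iff] at hx'
      exact ⟨p, q, by rw [hx', Set.insert_comm r p, Set.pair_comm r q]⟩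
  have hvert : ∀ q ∈ s, ∃ a, toPlane (x + a) = q := by
    intro q hq
    obtain ⟨y, rfl⟩ := mem_image_of_mem_face T hs hq
    exact ⟨y - x, by rw [add_sub_cancel]⟩
  obtain ⟨a, rfl⟩ := hvert q (by rw [← Finset.mem_coe, hqr]; simp)
  obtain ⟨b, rfl⟩ := hvert r (by rw [← Finset.mem_coe, hqr]; simp)
  obtain ⟨α, β, γ, hα, hβ, hγ, hsum, hcomb⟩ := mem_convexHull_triple (hqr ▸ hεs)
  have hdir : ∀ {a b : ℤ × ℤ} {α β γ : ℝ}, 0 ≤ β → 0 ≤ γ → α + β + γ = 1 →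
      (s : Set (ℝ × ℝ)) = {toPlane x, toPlane (x + a), toPlane (x + b)} →
      α • toPlane x + β • toPlane (x + a) + γ • toPlane (x + b) = toPlane x + ε • toPlane e →
      0 < cross a b → 0 ≤ formP x e f g (fun z => interp T u (toPlane z)) := by
    intro a b α β γ hβ hγ hsum hset hcomb hD
    have has : toPlane (x + a) ∈ s := by rw [← Finset.mem_coe, hset]; simp
    have hbs : toPlane (x + b) ∈ s := by rw [← Finset.mem_coe, hset]; simp
    have c1 : β * a.1 + γ * b.1 = ε * e.1 := by
      have := congrArg Prod.fst hcomb
      simp [toPlane] at this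
      linear_combination this - x.1.1 * hsum
    have c2 : β * a.2 + γ * b.2 = ε * e.2 := by
      have := congrArg Prod.snd hcomb
      simp [toPlane] at this
      linear_combination this - x.1.2 * hsum
    have d1 : ε * (cross e b : ℤ) = β * (cross a b : ℤ) := by
      simp only [cross]; push_cast; linear_combination b.1 * c2 - b.2 * c1
    have d2 : ε * (cross a e : ℤ) = γ * (cross a b : ℤ) := by
      simp only [cross]; push_cast; linear_combination a.2 * c1 - a.1 * c2
    have hee : (0 : ℝ) < (dot e e : ℤ) := by exact_mod_cast dot_self_pos he.1.ne_zero
    have d3 : β * (dot e a : ℤ) + γ * (dot e b : ℤ) = ε * (dot e e : ℤ) := by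
      simp only [dot]; push_cast; linear_combination e.1 * c1 + e.2 * c2
    have hDr : (0 : ℝ) < (cross a b : ℤ) := by exact_mod_cast hD
    have hpos := mul_pos hε0 hee
    have hβ0 : 0 < β := by
      refine hβ.lt_of_ne fun h0 => ?_
      rw [← h0, zero_mul] at d1 d3
      refine hpar b hbs (by exact_mod_cast (mul_eq_zero.1 d1).resolve_left hε0.ne') ?_
      have : (0 : ℝ) < (dot e b : ℤ) := by
        by_contra! hc
        have := mul_nonpos_of_nonneg_of_nonpos hγ hc
        linarith
      exact_mod_cast this
    have hγ0 : 0 < γ := by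
      refine hγ.lt_of_ne fun h0 => ?_
      rw [← h0, zero_mul] at d2 d3
      have h5 : cross a e = 0 := by exact_mod_cast (mul_eq_zero.1 d2).resolve_left hε0.ne'
      refine hpar a has (by simp only [cross] at *; linarith) ?_
      have : (0 : ℝ) < (dot e a : ℤ) := by
        by_contra! hc
        have := mul_nonpos_of_nonneg_of_nonpos hβ hc
        linarith
      exact_mod_cast this
    have hi : 1 ≤ cross e b := by
      have : (0 : ℝ) < (cross e b : ℤ) := by
        by_contra! hc
        have := mul_nonpos_of_nonneg_of_nonpos hε0.le hc
        have := mul_pos hβ0 hDr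
        linarith
      exact_mod_cast this
    have hj : 1 ≤ cross a e := by
      have : (0 : ℝ) < (cross a e : ℤ) := by
        by_contra! hc
        have := mul_nonpos_of_nonneg_of_nonpos hε0.le hc
        have := mul_pos hγ0 hDr
        linarith
      exact_mod_cast this
    -- Otherwise the triangle contains a fourth integer point, which would have to be a vertex of
    -- the face.
    have hD1 : cross a b = 1 := by
      by_contra hD1
      obtain ⟨y, i, j, h1, h2, h3, h4, h5, h6, h7, h8⟩ :=
        exists_point_of_two_le_cross (b := a) (c := b) (by omega)
      have hy : toPlane (x + y) ∈ s := by
        refine mem_of_toPlane_mem_convexHull hX T hs (toPlane_mem_of_convex (convex_convexHull ℝ _)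
          (hsub hxs) (hsub has) (hsub hbs) (i := cross a b - i - j) (j := i) (k := j)
          (n := cross a b) (by omega) h1 h2 hD (by ring) ?_ ?_)
        · simp only [Prod.fst_add]; linear_combination h7
        · simp only [Prod.snd_add]; linear_combination h8
      have k1 : cross a b * cross y b = cross a b * i := by
        have : cross a b * cross y b = (cross a b * y.1) * b.2 - (cross a b * y.2) * b.1 := by
          simp only [cross]; ring
        rw [this, h7, h8]; simp only [cross]; ring
      have k2 : cross a b * cross a y = cross a b * j := by
        have : cross a b * cross a y = a.1 * (cross a b * y.2) - a.2 * (cross a b * y.1) := by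
          simp only [cross]; ring
        rw [this, h7, h8]; simp only [cross]; ring
      replace k1 := mul_left_cancel₀ hD.ne' k1
      replace k2 := mul_left_cancel₀ hD.ne' k2
      rw [← Finset.mem_coe, hset] at hy
      rcases hy with hy | hy | hy
      · have hy0 : y = 0 := by simpa using toPlane_injective hy
        rw [hy0] at k1 k2
        simp only [cross, Prod.fst_zero, Prod.snd_zero] at k1 k2
        omega
      · rw [add_left_cancel (toPlane_injective hy)] at k1
        omega
      · rw [add_left_cancel (toPlane_injective (Set.mem_singleton_iff.1 hy))] at k2
        omega
    have ha0 : a ≠ 0 := by rintro rfl; simp [cross] at hD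
    have hb0 : b ≠ 0 := by rintro rfl; simp [cross] at hD
    obtain ⟨k1, k2, k3, k4⟩ := cross_nonneg_of_adjacent hp hD1 hi hj
      (V.not_descendant hX x he.2 hne hp (hedge a has ha0))
      (V.not_descendant hX x he.2 hne hp (hedge b hbs hb0))
    refine formP_nonneg_of_cone hu (hmemX a has) (hmemX b hbs) he.2 hD1 hp k1 k2 k3 k4 ?_
    -- The interpolant is affine on the face and convex along `[x, x + e]`, so at `x + e` it is
    -- above the affine extension from the face.
    have i1 := interp_triple T u hs hxs has hbs hsum (by rw [hcomb]; exact hεs)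
    have i2 := hu.2 (toPlane_mem_hull x.2) (toPlane_mem_hull he.2) (sub_nonneg.2 hε1) hε0.le
      (by ring)
    have i3 : (1 - ε) • toPlane x + ε • toPlane (x + e) = toPlane x + ε • toPlane e := by
      rw [toPlane_add]; module
    rw [hcomb] at i1
    rw [i3, i1, smul_eq_mul, smul_eq_mul] at i2
    rw [hD1, Int.cast_one, mul_one] at d1 d2
    have i4 : α = 1 - β - γ := by linarith
    rw [i4, ← d1, ← d2] at i2
    refine le_of_mul_le_mul_left ?_ hε0
    linarith
  rcases lt_trichotomy (cross a b) 0 with h | h | h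
  · refine hdir (a := b) (b := a) (α := α) hγ hβ (by linarith) (by rw [hqr, Set.pair_comm])
      (by rw [← hcomb]; abel) ?_
    simp only [cross] at *; linarith
  -- In a degenerate face `a` and `b` are parallel to `e`, and by `d3` one of them points in its
  -- direction.
  · exfalso
    have has : toPlane (x + a) ∈ s := by rw [← Finset.mem_coe, hqr]; simp
    have hbs : toPlane (x + b) ∈ s := by rw [← Finset.mem_coe, hqr]; simp
    have c1 : β * a.1 + γ * b.1 = ε * e.1 := by
      have := congrArg Prod.fst hcomb
      simp [toPlane] at this
      linear_combination this - x.1.1 * hsum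
    have c2 : β * a.2 + γ * b.2 = ε * e.2 := by
      have := congrArg Prod.snd hcomb
      simp [toPlane] at this
      linear_combination this - x.1.2 * hsum
    have h' : (a.1 * b.2 - a.2 * b.1 : ℝ) = 0 := by exact_mod_cast h
    have d1 : cross e b = 0 := by
      have : ε * (e.1 * b.2 - e.2 * b.1 : ℝ) = 0 := by
        linear_combination b.1 * c2 - b.2 * c1 + β * h'
      have := (mul_eq_zero.1 this).resolve_left hε0.ne'
      simp only [cross]
      exact_mod_cast this
    have d2 : cross e a = 0 := by
      have : ε * (e.1 * a.2 - e.2 * a.1 : ℝ) = 0 := by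
        linear_combination a.1 * c2 - a.2 * c1 - γ * h'
      have := (mul_eq_zero.1 this).resolve_left hε0.ne'
      simp only [cross]
      exact_mod_cast this
    have hee : (0 : ℝ) < (dot e e : ℤ) := by exact_mod_cast dot_self_pos he.1.ne_zero
    have d3 : β * (dot e a : ℤ) + γ * (dot e b : ℤ) = ε * (dot e e : ℤ) := by
      simp only [dot]; push_cast; linear_combination e.1 * c1 + e.2 * c2
    have hpos := mul_pos hε0 hee
    by_cases j1 : 0 < dot e a
    · exact hpar a has d2 j1
    by_cases j2 : 0 < dot e b
    · exact hpar b hbs d1 j2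
    have j1' : ((dot e a : ℤ) : ℝ) ≤ 0 := by exact_mod_cast not_lt.1 j1
    have j2' : ((dot e b : ℤ) : ℝ) ≤ 0 := by exact_mod_cast not_lt.1 j2
    have := mul_nonpos_of_nonneg_of_nonpos hβ j1'
    have := mul_nonpos_of_nonneg_of_nonpos hγ j2'
    linarith
  · exact hdir hβ hγ hsum hqr hcomb h

/-- For `S` and `T`, `x` is the barycentre of the other points of the form, so Jensen's inequality
for the interpolant suffices. -/
theorem convTriangulation_subset_convStencils (hX : LatticeConvex X) (hXf : X.Finite)
    (V : Stencils X) (T : Triangulation X) (hT : T.Prec V) :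
    convTriangulation T ⊆ convStencils V := by
  intro u hu x
  have hval : ∀ z ∈ X, extend u z = interp T u (toPlane z) := fun z hz => by
    rw [extend_of_mem u hz]
    exact (interp_vertex T u ⟨z, hz⟩).symm
  refine ⟨fun e _ h2 h3 => ?_, fun e _ f g hp h3 h4 h5 => ?_, fun e he hne f g hp hf hg => ?_⟩
  · have := toPlane_le_of_convexOn hu (toPlane_mem_hull h2) (toPlane_mem_hull h3)
      (toPlane_mem_hull x.2) (z := x) (i := 1) (j := 1) (k := 0) (n := 2) (by norm_num)
      (by norm_num) le_rfl (by norm_num) (by norm_num)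
      (by simp only [Prod.fst_add, Prod.fst_sub]; ring)
      (by simp only [Prod.snd_add, Prod.snd_sub]; ring)
    rw [formS, hval _ h2, hval _ h3, hval _ x.2]
    push_cast at this
    linarith
  · have hefg := hp.eq_add
    have := toPlane_le_of_convexOn hu (toPlane_mem_hull h3) (toPlane_mem_hull h4)
      (toPlane_mem_hull h5) (z := x) (i := 1) (j := 1) (k := 1) (n := 3) (by norm_num)
      (by norm_num) (by norm_num) (by norm_num) (by norm_num)
      (by simp only [hefg, Prod.fst_add, Prod.fst_sub]; ring)
      (by simp only [hefg, Prod.snd_add, Prod.snd_sub]; ring)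
    rw [formT, hval _ h3, hval _ h4, hval _ h5, hval _ x.2]
    push_cast at this
    linarith
  · have := formP_nonneg_of_prec hX hXf V T hT hu x he hne hp
    rw [formP] at this ⊢
    rwa [hval _ he.2, hval _ (V.add_mem hf), hval _ (V.add_mem hg), hval _ x.2]

end Converse

end GridConv

end

theorem mainTheorem7 (Ω : Set (ℝ × ℝ)) (hΩ : Convex ℝ Ω) (hΩc : IsCompact Ω)
    (hX : (interior (GridConv.hull (GridConv.gridPoints Ω))).Nonempty)
    (V : GridConv.Stencils (GridConv.gridPoints Ω))
    (hV : (interior (GridConv.convStencils V)).Nonempty) :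
    GridConv.convStencils V =
      ⋃ (T : GridConv.Triangulation (GridConv.gridPoints Ω)) (_ : T.Prec V),
        GridConv.convTriangulation T :=
  Set.Subset.antisymm
    (GridConv.convStencils_subset_iUnion (GridConv.latticeConvex_gridPoints hΩ)
      (GridConv.finite_gridPoints hΩc) hX V hV)
    (Set.iUnion₂_subset fun T hT => GridConv.convTriangulation_subset_convStencils
      (GridConv.latticeConvex_gridPoints hΩ) (GridConv.finite_gridPoints hΩc) V T hT)
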